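/- Let $k$ be an algebraically closed field and let $C$ be a curve over $k$, i.e. a reduced connected one-dimensional scheme of finite type over $k$. Let $p \in C$ be a point, let $\pi : \tilde C \to C$ be the normalization of $C$ at $p$, and put $$\delta(p) = \dim_k \bigl((\pi_*\mathcal O_{\tilde C})_p/\mathcal O_{C,p}\bigr), \qquad m(p) = |\pi^{-1}(p)|, \qquad g(p) = \delta(p) - m(p) + 1 .$$ Here $(\pi_*\mathcal O_{\tilde C})_p$ is the integral closure of $\mathcal O_{C,p}$ in its total ring of fractions, and $m(p)$ and $g(p)$ are called the number of branches and the genus of $p$. Suppose that $C$ is Gorenstein at $p$ (the dualizing sheaf $\omega_C$ is invertible near $p$; equivalently, $\mathcal O_{C,p}$ is a Gorenstein local ring, i.e. it has finite injective dimension as a module over itself), that $m(p) = m$ and that $g(p) = 1$. Then $p$ is an elliptic $m$-fold point of $C$, i.e. $m \geq 1$ and there is an isomorphism of $k$-algebras $$\hat{\mathcal O}_{C,p} \simeq \begin{cases} k[[x,y]]/(y^2-x^3) & m=1 \ \text{(cusp)},\\ k[[x,y]]/(y(y-x^2)) & m=2 \ \text{(tacnode)},\\ k[[x,y]]/(xy(y-x))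 & m=3 \ \text{(planar triple point)},\\ k[[x_1,\ldots,x_{m-1}]]/I_m & m\geq 4,\end{cases}$$ where $I_m$ is the ideal generated by all $x_h(x_i-x_j)$ with $i,j,h\in\{1,\ldots,m-1\}$ distinct. -/

import Mathlib

open AlgebraicGeometry CategoryTheory IsLocalRing

universe u

noncomputable section

namespace CurveSing

/-! ### Local rings -/

/-- A Gorenstein local ring: a Noetherian local ring that has finite injective dimension as a
module over itself. -/
structure IsGorensteinLocalRing (R : Type u) [CommRing R] : Prop where
  isLocalRing : IsLocalRing R
  isNoetherianRing : IsNoetherianRing R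
  finite_injectiveDimension : ∃ n : ℕ, HasInjectiveDimensionLE (ModuleCat.of R R) n

/-- The normalization of a (reduced) ring: its integral closure in its total ring of fractions,
that is, in the localization at all non-zero-divisors. -/
abbrev normalizationRing (R : Type u) [CommRing R] : Subalgebra R (FractionRing R) :=
  integralClosure R (FractionRing R)

/-- The `δ`-invariant of a local `k`-algebra `R`: the dimension over `k` of `R̃ / R`, where `R̃` is
the normalization of `R`. -/
def deltaInvariant (k R : Type u) [Field k] [CommRing R] [Algebra k R] : ℕ :=
  Module.finrank k
    (normalizationRing R ⧸ LinearMap.range (Algebra.linearMap R (normalizationRing R)))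

/-- The number of branches of a local ring `R`: the number of points of `Spec R̃` that lie over the
closed point of `Spec R`, where `R̃` is the normalization of `R`. -/
def branchNumber (R : Type u) [CommRing R] [IsLocalRing R] : ℕ∞ :=
  (PrimeSpectrum.comap (algebraMap R (normalizationRing R)) ⁻¹' {closedPoint R}).encard

/-- The genus `δ - m + 1` of a local `k`-algebra with `m` branches. -/
def genus (k R : Type u) [Field k] [CommRing R] [IsLocalRing R] [Algebra k R] : ℤ :=
  (deltaInvariant k R : ℤ) - ((branchNumber R).toNat : ℤ) + 1

/-! ### The complete local rings of the elliptic `m`-fold points -/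

/-- The equation `y ^ 2 - x ^ 3` of the cusp, in `k[[x, y]]`. -/
def cuspIdeal (k : Type u) [Field k] : Ideal (MvPowerSeries (Fin 2) k) :=
  Ideal.span {MvPowerSeries.X 1 ^ 2 - MvPowerSeries.X 0 ^ 3}

/-- The equation `y (y - x ^ 2)` of the tacnode, in `k[[x, y]]`. -/
def tacnodeIdeal (k : Type u) [Field k] : Ideal (MvPowerSeries (Fin 2) k) :=
  Ideal.span {MvPowerSeries.X 1 * (MvPowerSeries.X 1 - MvPowerSeries.X 0 ^ 2)}

/-- The equation `x y (y - x)` of the planar triple point, in `k[[x, y]]`. -/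
def triplePointIdeal (k : Type u) [Field k] : Ideal (MvPowerSeries (Fin 2) k) :=
  Ideal.span {MvPowerSeries.X 0 * MvPowerSeries.X 1 * (MvPowerSeries.X 1 - MvPowerSeries.X 0)}

/-- The ideal of `k[[x_1, …, x_n]]` generated by all the quadrics `x_h (x_i - x_j)` with
`h`, `i`, `j` distinct. -/
def generalLinesIdeal (k : Type u) [Field k] (n : ℕ) : Ideal (MvPowerSeries (Fin n) k) :=
  Ideal.span {q | ∃ h i j : Fin n, h ≠ i ∧ h ≠ j ∧ i ≠ j ∧
    q = MvPowerSeries.X h * (MvPowerSeries.X i - MvPowerSeries.X j)}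

/-- The `k`-algebra `A` is isomorphic to the complete local ring of the elliptic `m`-fold point. -/
def IsEllipticAlgebra (k A : Type u) [Field k] [CommRing A] [Algebra k A] : ℕ → Prop
  | 0 => False
  | 1 => Nonempty (A ≃ₐ[k] MvPowerSeries (Fin 2) k ⧸ cuspIdeal k)
  | 2 => Nonempty (A ≃ₐ[k] MvPowerSeries (Fin 2) k ⧸ tacnodeIdeal k)
  | 3 => Nonempty (A ≃ₐ[k] MvPowerSeries (Fin 2) k ⧸ triplePointIdeal k)
  | m + 4 => Nonempty (A ≃ₐ[k] MvPowerSeries (Fin (m + 3)) k ⧸ generalLinesIdeal k (m + 3))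

/-! ### Curves and their points -/

/-- A curve over a field `k`: a reduced connected scheme of finite type over `k` of dimension
one. -/
structure IsCurve {k : Type u} [Field k] {C : Scheme.{u}} (f : C ⟶ Spec (CommRingCat.of k)) :
    Prop where
  isReduced : IsReduced C
  connectedSpace : ConnectedSpace C
  locallyOfFiniteType : LocallyOfFiniteType f
  quasiCompact : QuasiCompact f
  dim_eq_one : topologicalKrullDim C = 1

section Point

variable {k : Type u} [Field k] {C : Scheme.{u}} (f : C ⟶ Spec (CommRingCat.of k)) (p : C)

/-- The `k`-algebra structure on the local ring of a `k`-scheme at a point. -/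
@[reducible]
def stalkAlgebra : Algebra k (C.presheaf.stalk p) :=
  ((Scheme.ΓSpecIso (CommRingCat.of k)).inv ≫ f.appTop ≫
    C.presheaf.germ ⊤ p trivial).hom.toAlgebra

/-- `p` is a Gorenstein point of `C`. -/
def IsGorensteinAt : Prop :=
  IsGorensteinLocalRing (C.presheaf.stalk p)

/-- The number of branches of `C` at `p`, that is, the number of points over `p` of the
normalization of `C` at `p`. -/
def branchNumberAt : ℕ∞ :=
  branchNumber (C.presheaf.stalk p)

/-- The genus `δ(p) - m(p) + 1` of a point of a curve. -/
def genusAt : ℤ :=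
  letI := stalkAlgebra f p
  genus k (C.presheaf.stalk p)

/-- `p` is an elliptic `m`-fold point of `C`: the completed local ring of `C` at `p` is, as a
`k`-algebra, the one of the elliptic `m`-fold point. -/
def IsEllipticFoldPoint (m : ℕ) : Prop :=
  letI := stalkAlgebra f p
  IsEllipticAlgebra k
    (AdicCompletion (maximalIdeal (C.presheaf.stalk p)) (C.presheaf.stalk p)) m

end Point

end CurveSing

end

/-!
Let `R` be the local ring of the curve at the point, `S` its normalization, and `J` the intersection
of the `m` maximal ideals of `S` over the closed point. Genus one means `δ = m`, so that `S ⧸ R` is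
finite-dimensional over `k` and `S` is a finite `R`-module.

*Branches.* The maximal ideals of `S` over the closed point are locally generated by one
non-zero-divisor (`exists_local_generator`) and have residue field `k`, so the elements of `S` have
a power series expansion at each of them (`exists_branch_expansion`). By the Chinese remainder
theorem these expansions identify the `J`-adic completion of `S` with `k⟦t⟧ ^ m`
(`exists_isBranchExpansion`).

*Genus one.* The `m` values on the branches of an element of `R` are equal, which accounts for
`m - 1` of the `m` dimensions of `S ⧸ R`. Hence `R` contains all but one dimension of `J`
(`IsBranchExpansion.exists_generator_mod`). As it also contains a power of `J`, it contains `J ^ 2`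
(`IsGluing.sq_le`), and so `R` consists of the elements of `S` whose values on the branches agree
and whose linear coefficients `t_i` satisfy one equation `∑ a_i t_i = 0`
(`IsBranchExpansion.exists_forall_mem_iff`).

*Gorenstein.* For a non-zero-divisor `x` in the maximal ideal, `R ⧸ (x)` is self-injective
(`exists_smul_eq_of_annihilator_le`; only the vanishing of `Ext^2(N, R)` for `N` of finite length
is used). Thus `R` has type one (`exists_sub_mul_mem_range`), and this forces all `a_i` to be
nonzero (`IsBranchExpansion.coefficient_ne_zero`): a branch that does not occur in the equation
would contribute a second dimension to the socle.

*Completion.* After rescaling the parameters of the branches, the equation says that one linear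
coefficient is the sum of the others. The completion of `R` is therefore the subalgebra `foldRing`
of `k⟦t⟧ ^ m` that is defined by these conditions (`nonempty_adicCompletion_equiv_foldRing`), and
depends only on `m`. It remains to present `foldRing` by equations. It is the ring of functions on
the cusp `(t ^ 2, t ^ 3)` for `m = 1`, on the tacnode `(t, 0)`, `(t, t ^ 2)` for `m = 2`, and on the
union of the coordinate axes and the diagonal of affine `(m - 1)`-space for `m ≥ 3`; in each case a
normal form modulo the given equations is determined by its restrictions to the branches
(`nonempty_foldRing_equiv_quotient`).
-/

namespace CurveSing

/-! ### Rings of finite injective dimension -/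

section Ext

open Abelian

variable {R : Type u} [CommRing R]

lemma shortExact_submodule {M : Type u} [AddCommGroup M] [Module R M] (N : Submodule R M)
    (w : ModuleCat.ofHom N.subtype ≫ ModuleCat.ofHom N.mkQ = 0) :
    (ShortComplex.mk (ModuleCat.ofHom N.subtype) (ModuleCat.ofHom N.mkQ) w).ShortExact := by
  refine ModuleCat.shortComplex_shortExact _ ?_ N.subtype_injective N.mkQ_surjective
  exact LinearMap.exact_subtype_mkQ N

lemma shortExact_mul {x : R} (hx : x ∈ nonZeroDivisors R)
    (w : ModuleCat.ofHom (LinearMap.lsmul R R x) ≫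
      ModuleCat.ofHom (Ideal.span {x}).mkQ = 0) :
    (ShortComplex.mk (ModuleCat.ofHom (LinearMap.lsmul R R x))
      (ModuleCat.ofHom (Ideal.span {x}).mkQ) w).ShortExact := by
  refine ModuleCat.shortComplex_shortExact _ ?_ ?_ (Submodule.mkQ_surjective _)
  · intro y
    simp only [ModuleCat.hom_ofHom, Submodule.mkQ_apply]
    rw [Submodule.Quotient.mk_eq_zero, Ideal.mem_span_singleton']
    simp [mul_comm]
  · intro a b hab
    simp only [ModuleCat.hom_ofHom, LinearMap.lsmul_apply, smul_eq_mul] at hab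
    exact mul_cancel_left_mem_nonZeroDivisors hx |>.mp hab

lemma mkQ_comp_lsmul {x : R} : ModuleCat.ofHom (LinearMap.lsmul R R x) ≫
      ModuleCat.ofHom (Ideal.span {x}).mkQ = 0 := by
  ext
  simp

lemma subtype_comp_mkQ {M : Type u} [AddCommGroup M] [Module R M] (N : Submodule R M) :
    ModuleCat.ofHom N.subtype ≫ ModuleCat.ofHom N.mkQ = 0 := by
  ext x
  simp

/-- Higher `Ext` groups from `R ⧸ (x)` vanish above degree one, because of the resolution
`0 → R → R → R ⧸ (x) → 0`. -/
lemma ext_quotient_span_eq_zero {x : R} (hx : x ∈ nonZeroDivisors R) {i : ℕ} (hi : 2 ≤ i)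
    (Y : ModuleCat.{u} R) (e : Ext (ModuleCat.of R (R ⧸ Ideal.span {x})) Y i) : e = 0 := by
  obtain ⟨j, rfl⟩ : ∃ j, i = 1 + (j + 1) := ⟨i - 2, by omega⟩
  obtain ⟨y, hy⟩ := Ext.contravariant_sequence_exact₃ (shortExact_mul hx mkQ_comp_lsmul) Y e
    (by
      have : Projective (ModuleCat.of R R) := inferInstance
      have h := (Ext.subsingleton_of_projective (ModuleCat.of R R) Y (1 + j))
      exact @Subsingleton.elim _ h _ _) rfl
  have h := (Ext.subsingleton_of_projective (ModuleCat.of R R) Y j)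
  rw [← hy, @Subsingleton.elim _ h y 0, Ext.comp_zero]

lemma ext_eq_zero_of_linearEquiv {N N' : Type u} [AddCommGroup N] [Module R N] [AddCommGroup N']
    [Module R N'] (f : N ≃ₗ[R] N') {Y : ModuleCat.{u} R} {i : ℕ}
    (h : ∀ e : Ext (ModuleCat.of R N') Y i, e = 0) (e : Ext (ModuleCat.of R N) Y i) : e = 0 := by
  have h1 : ModuleCat.ofHom f.toLinearMap ≫ ModuleCat.ofHom f.symm.toLinearMap
      = 𝟙 (ModuleCat.of R N) := by
    ext; simp
  rw [← Ext.mk₀_id_comp e, ← h1, ← Ext.mk₀_comp_mk₀_assoc, h (Ext.comp _ e _), Ext.comp_zero]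

lemma ext_eq_zero_of_subsingleton {N : Type u} [AddCommGroup N] [Module R N] [Subsingleton N]
    {Y : ModuleCat.{u} R} {i : ℕ} (e : Ext (ModuleCat.of R N) Y i) : e = 0 := by
  have h1 : 𝟙 (ModuleCat.of R N) = 0 := by
    ext x
    exact @Subsingleton.elim N _ _ _
  rw [← Ext.mk₀_id_comp e, h1, Ext.mk₀_zero, Ext.zero_comp]

/-- Over a local ring `R` of finite injective dimension with a non-zero-divisor `x` such that
`R ⧸ (x)` has finite length, `Ext^i(N, R) = 0` for `i ≥ 2` and `N` of finite length. By descending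
induction on `i`: the residue field embeds into `R ⧸ (x)`, for which the claim is known, and
the cokernel contributes only to `Ext^(i + 1)`. -/
lemma ext_eq_zero_of_isFiniteLength [IsLocalRing R] {n : ℕ}
    (hR : HasInjectiveDimensionLE (ModuleCat.of R R) n)
    {x : R} (hx : x ∈ nonZeroDivisors R) (hxm : x ∈ maximalIdeal R)
    (hfin : IsFiniteLength R (R ⧸ Ideal.span {x})) (d : ℕ) :
    ∀ i : ℕ, 2 ≤ i → n + 1 ≤ i + d → ∀ {N : Type u} [AddCommGroup N] [Module R N],
      IsFiniteLength R N → ∀ e : Ext (ModuleCat.of R N) (ModuleCat.of R R) i, e = 0 := by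
  induction d with
  | zero =>
    intro i _ hi N _ _ _ e
    exact Ext.eq_zero_of_hasInjectiveDimensionLT e (n + 1) hi
  | succ d ih =>
    intro i hi hid
    have hart := (isFiniteLength_iff_isNoetherian_isArtinian.mp hfin)
    have := hart.1
    have := hart.2
    have hnt : Nontrivial (R ⧸ Ideal.span {x}) := by
      rw [Ideal.Quotient.nontrivial_iff, Ne, Ideal.span_singleton_eq_top]
      exact hxm
    obtain ⟨L, hL⟩ := IsAtomic.exists_atom (Submodule R (R ⧸ Ideal.span {x}))
    have hLs : IsSimpleModule R L := isSimpleModule_iff_isAtom.mpr hL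
    have hquot : IsFiniteLength R ((R ⧸ Ideal.span {x}) ⧸ L) :=
      hfin.of_surjective (Submodule.mkQ_surjective L)
    have hsimple : ∀ {T : Type u} [AddCommGroup T] [Module R T], IsSimpleModule R T →
        ∀ e : Ext (ModuleCat.of R T) (ModuleCat.of R R) i, e = 0 := by
      intro T _ _ hT
      obtain ⟨I, hI, ⟨f⟩⟩ := isSimpleModule_iff_quot_maximal.mp hT
      obtain ⟨I', hI', ⟨f'⟩⟩ := isSimpleModule_iff_quot_maximal.mp hLs
      obtain rfl : I = I' := (eq_maximalIdeal hI).trans (eq_maximalIdeal hI').symm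
      refine ext_eq_zero_of_linearEquiv (f.trans f'.symm) fun e => ?_
      obtain ⟨e', rfl⟩ := Ext.contravariant_sequence_exact₁
        (shortExact_submodule L (subtype_comp_mkQ L)) (ModuleCat.of R R) e rfl
        (ih (1 + i) (by omega) (by omega) hquot _)
      rw [ext_quotient_span_eq_zero hx hi _ e', Ext.comp_zero]
    intro N _ _ hN
    induction hN with
    | of_subsingleton => exact ext_eq_zero_of_subsingleton
    | @of_simple_quotient N _ _ N' hs _ ih' =>
      intro e
      obtain ⟨e', rfl⟩ := Ext.contravariant_sequence_exact₂
        (shortExact_submodule N' (subtype_comp_mkQ N')) (ModuleCat.of R R) e (ih' _)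
      rw [hsimple hs e', Ext.comp_zero]

/-- Self-injectivity of `A = R ⧸ (x)`, tested on the principal submodule `L` generated by `s₁`: the
homomorphism `L → A` with `s₁ ↦ s₂` extends to `A`. Through the connecting maps of
`0 → R → R → A → 0` this is the extension of a class in `Ext^1(L, R)` to `A`, and the obstruction
lies in `Ext^2(A ⧸ L, R) = 0`. -/
theorem exists_smul_eq_of_annihilator_le [IsLocalRing R] {n : ℕ}
    (hR : HasInjectiveDimensionLE (ModuleCat.of R R) n)
    {x : R} (hx : x ∈ nonZeroDivisors R) (hxm : x ∈ maximalIdeal R)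
    (hfin : IsFiniteLength R (R ⧸ Ideal.span {x})) (s₁ s₂ : R ⧸ Ideal.span {x})
    (h : ∀ r : R, r • s₁ = 0 → r • s₂ = 0) : ∃ a : R, s₂ = a • s₁ := by
  let A := R ⧸ Ideal.span {x}
  let L : Submodule R A := LinearMap.range (LinearMap.toSpanSingleton R A s₁)
  -- the map `L → A` with `s₁ ↦ s₂`
  obtain ⟨φ, hφ⟩ : ∃ φ : L →ₗ[R] A,
      φ ⟨s₁, ⟨1, by simp⟩⟩ = s₂ := by
    have hle : LinearMap.ker (LinearMap.toSpanSingleton R A s₁) ≤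
        LinearMap.ker (LinearMap.toSpanSingleton R A s₂) := fun r hr => by
      simpa using h r (by simpa using hr)
    refine ⟨(Submodule.liftQ _ _ hle) ∘ₗ
      ((LinearMap.toSpanSingleton R A s₁).quotKerEquivRange.symm : L →ₗ[R] _), ?_⟩
    have : (LinearMap.toSpanSingleton R A s₁).quotKerEquivRange.symm ⟨s₁, ⟨1, by simp⟩⟩ =
        Submodule.Quotient.mk 1 := by
      rw [LinearEquiv.symm_apply_eq]
      exact Subtype.ext (one_smul R s₁).symm
    rw [LinearMap.comp_apply, LinearEquiv.coe_coe, this]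
    exact one_smul R s₂
  have hS := shortExact_mul hx mkQ_comp_lsmul
  have hL := shortExact_submodule L (subtype_comp_mkQ L)
  -- the class of `φ` in `Ext^1(L, R)` extends to `A`
  obtain ⟨ψ, hψ⟩ := Ext.contravariant_sequence_exact₁ hL (ModuleCat.of R R)
    ((Ext.mk₀ (ModuleCat.ofHom φ)).comp hS.extClass (zero_add 1)) rfl
    (ext_eq_zero_of_isFiniteLength hR hx hxm hfin (n + 1) 2 le_rfl (by omega)
      (hfin.of_surjective (Submodule.mkQ_surjective L)) _)
  -- and the extension is the class of an endomorphism of `A`, as `x` kills `Ext^1(A, R)`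
  obtain ⟨g, hg⟩ := Ext.covariant_sequence_exact₁ _ hS ψ (by
    have h1 : ModuleCat.ofHom (LinearMap.lsmul R R x) = x • 𝟙 (ModuleCat.of R R) := by
      ext; simp
    have h2 : x • 𝟙 (ModuleCat.of R A) = 0 := by
      refine ModuleCat.hom_ext (LinearMap.ext fun a => ?_)
      obtain ⟨a, rfl⟩ := Submodule.Quotient.mk_surjective _ a
      simp only [ModuleCat.hom_smul, ModuleCat.hom_id, LinearMap.smul_apply, LinearMap.id_coe,
        id_eq, ModuleCat.hom_zero, LinearMap.zero_apply]
      rw [← Submodule.Quotient.mk_smul, Submodule.Quotient.mk_eq_zero]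
      exact Ideal.mul_mem_right _ _ (Ideal.mem_span_singleton_self x)
    change ψ.comp (Ext.mk₀ (ModuleCat.ofHom (LinearMap.lsmul R R x))) _ = 0
    rw [h1, ← Ext.smul_eq_comp_mk₀, ← Ext.mk₀_id_comp ψ, ← Ext.smul_comp, ← Ext.mk₀_smul]
    change (Ext.mk₀ (x • 𝟙 (ModuleCat.of R A))).comp ψ _ = 0
    rw [h2, Ext.mk₀_zero, Ext.zero_comp]) (n₀ := 0) rfl
  obtain ⟨g, rfl⟩ := Ext.mk₀_bijective _ _ |>.2 g
  -- `g` restricts to `φ`, because there are no homomorphisms from `L` to `R`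
  have hdiff : (Ext.mk₀ (ModuleCat.ofHom L.subtype ≫ g - ModuleCat.ofHom φ)).comp hS.extClass
      (zero_add 1) = 0 := by
    rw [sub_eq_add_neg, Ext.mk₀_add, Ext.mk₀_neg, Ext.add_comp, Ext.neg_comp, ← hψ, ← hg,
      ← Ext.mk₀_comp_mk₀_assoc, add_neg_cancel]
  obtain ⟨u, hu⟩ := Ext.covariant_sequence_exact₃ _ hS _ _ hdiff
  obtain ⟨u, rfl⟩ := Ext.mk₀_bijective _ _ |>.2 u
  have hu0 : u = 0 := by
    ext l
    have h1 : x • l = 0 := by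
      obtain ⟨l, hl⟩ := l
      obtain ⟨a, rfl⟩ := Submodule.Quotient.mk_surjective _ l
      apply Subtype.ext
      change x • Submodule.Quotient.mk a = (0 : A)
      rw [← Submodule.Quotient.mk_smul, Submodule.Quotient.mk_eq_zero]
      exact Ideal.mul_mem_right _ _ (Ideal.mem_span_singleton_self x)
    have h2 : x * u.hom l = 0 := by
      rw [← smul_eq_mul]
      erw [← map_smul u.hom x l, h1, map_zero]
    exact mul_left_mem_nonZeroDivisors_eq_zero_iff hx |>.mp h2
  rw [hu0, Ext.mk₀_zero, Ext.zero_comp, eq_comm, Ext.mk₀_eq_zero_iff, sub_eq_zero] at hu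
  have key : g.hom s₁ = s₂ := by
    rw [← hφ]
    exact congrArg (fun f => f.hom ⟨s₁, ⟨1, by simp⟩⟩) hu
  obtain ⟨a, ha⟩ := Submodule.Quotient.mk_surjective _ (g.hom (1 : A))
  refine ⟨a, ?_⟩
  obtain ⟨b, rfl⟩ := Submodule.Quotient.mk_surjective _ s₁
  have hb : (Submodule.Quotient.mk b : A) = b • (1 : A) := by
    change _ = b • (Submodule.Quotient.mk (1 : R) : A)
    rw [← Submodule.Quotient.mk_smul, smul_eq_mul, mul_one]
  rw [← key, ← Submodule.Quotient.mk_smul, smul_eq_mul, mul_comm, ← smul_eq_mul,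
    Submodule.Quotient.mk_smul, ha]
  exact (congrArg g.hom hb).trans (map_smul g.hom b (1 : A))

end Ext

/-! ### Power series expansion in a local parameter -/

section Taylor

open PowerSeries

variable {k T : Type u} [Field k] [CommRing T] [Algebra k T]

/-- The data needed to expand the elements of a `k`-algebra `T` in powers of `t`: a
non-zero-divisor `t` that generates the kernel of a `k`-algebra homomorphism `ε : T → k`. -/
structure IsParameter (t : T) (ε : T →ₐ[k] k) : Prop where
  nonZeroDivisor : t ∈ nonZeroDivisors T
  ker_eq : RingHom.ker ε = Ideal.span {t}

namespace IsParameter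

variable {t : T} {ε : T →ₐ[k] k} (h : IsParameter t ε)

include h

lemma exists_eq_add_mul (f : T) : ∃ g, f = algebraMap k T (ε f) + t * g := by
  have : f - algebraMap k T (ε f) ∈ RingHom.ker ε := by
    simp [RingHom.mem_ker]
  rw [h.ker_eq, Ideal.mem_span_singleton] at this
  obtain ⟨g, hg⟩ := this
  exact ⟨g, by rw [← hg]; ring⟩

/-- The difference quotient `(f - f(0)) / t`. -/
noncomputable def divDiff (f : T) : T := (h.exists_eq_add_mul f).choose

lemma eq_add_mul_divDiff (f : T) : f = algebraMap k T (ε f) + t * h.divDiff f :=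
  (h.exists_eq_add_mul f).choose_spec

lemma map_eq_zero : ε t = 0 := by
  have : t ∈ RingHom.ker ε := by
    rw [h.ker_eq]
    exact Ideal.mem_span_singleton_self t
  exact this

lemma divDiff_eq {f g : T} {c : k} (hf : f = algebraMap k T c + t * g) : h.divDiff f = g := by
  have hc : ε f = c := by
    rw [hf]
    simp [h.map_eq_zero]
  have h1 := h.eq_add_mul_divDiff f
  rw [hc] at h1
  exact mul_cancel_left_mem_nonZeroDivisors h.nonZeroDivisor |>.mp
    (add_left_cancel (h1.symm.trans hf))

lemma divDiff_add (f g : T) : h.divDiff (f + g) = h.divDiff f + h.divDiff g := by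
  refine h.divDiff_eq (c := ε f + ε g) ?_
  conv_lhs => rw [h.eq_add_mul_divDiff f, h.eq_add_mul_divDiff g]
  rw [map_add]
  ring

lemma divDiff_mul (f g : T) :
    h.divDiff (f * g) = h.divDiff f * g + algebraMap k T (ε f) * h.divDiff g := by
  refine h.divDiff_eq (c := ε f * ε g) ?_
  conv_lhs => rw [h.eq_add_mul_divDiff f]
  rw [add_mul]
  conv_lhs => enter [1]; rw [h.eq_add_mul_divDiff g]
  rw [map_mul]
  ring

lemma divDiff_algebraMap (c : k) : h.divDiff (algebraMap k T c) = 0 :=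
  h.divDiff_eq (c := c) (by simp)

lemma divDiff_self : h.divDiff t = 1 :=
  h.divDiff_eq (c := 0) (by simp)

/-- The power series with coefficients `ε (D ^ n f)`, where `D` is the difference quotient. -/
noncomputable def expand (f : T) : k⟦X⟧ := PowerSeries.mk fun n => ε (h.divDiff^[n] f)

lemma expand_eq (f : T) : h.expand f = C (ε f) + X * h.expand (h.divDiff f) := by
  ext n
  cases n with
  | zero => simp [expand]
  | succ n => simp [expand, coeff_succ_X_mul]

lemma expand_add (f g : T) : h.expand (f + g) = h.expand f + h.expand g := by
  ext n
  simp only [expand, coeff_mk, map_add]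
  induction n generalizing f g with
  | zero => simp
  | succ n ih =>
    rw [Function.iterate_succ_apply, h.divDiff_add, ih]
    rfl

lemma expand_algebraMap (c : k) : h.expand (algebraMap k T c) = C c := by
  have h0 : h.expand 0 = 0 := by
    have := h.expand_add 0 0
    simpa using this
  rw [expand_eq, divDiff_algebraMap, h0]
  simp

lemma expand_mul (f g : T) : h.expand (f * g) = h.expand f * h.expand g := by
  rw [← sub_eq_zero]
  suffices H : ∀ n f g, X ^ n ∣ h.expand (f * g) - h.expand f * h.expand g by
    ext n
    exact X_pow_dvd_iff.mp (H (n + 1) f g) n (Nat.lt_succ_self n)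
  intro n
  induction n with
  | zero => simp
  | succ n ih =>
    intro f g
    have h1 : h.expand (f * g) - h.expand f * h.expand g =
        X * ((h.expand (h.divDiff f * g) - h.expand (h.divDiff f) * h.expand g) +
          (h.expand (algebraMap k T (ε f) * h.divDiff g) -
            h.expand (algebraMap k T (ε f)) * h.expand (h.divDiff g))) := by
      rw [h.expand_eq (f * g), h.divDiff_mul, h.expand_add, h.expand_algebraMap]
      conv_lhs => enter [2]; rw [h.expand_eq f, add_mul]; enter [1]; rw [h.expand_eq g]
      rw [map_mul, map_mul]
      ring
    rw [h1, pow_succ']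
    exact mul_dvd_mul_left X (dvd_add (ih _ _) (ih _ _))

/-- The expansion of the elements of `T` as power series in the parameter `t`. -/
noncomputable def taylor : T →ₐ[k] k⟦X⟧ where
  toFun := h.expand
  map_one' := by simpa using h.expand_algebraMap 1
  map_mul' := h.expand_mul
  map_zero' := by simpa using h.expand_algebraMap 0
  map_add' := h.expand_add
  commutes' := h.expand_algebraMap

lemma taylor_eq (f : T) : h.taylor f = C (ε f) + X * h.taylor (h.divDiff f) := h.expand_eq f

lemma taylor_self : h.taylor t = X := by
  rw [taylor_eq, divDiff_self, h.map_eq_zero]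
  simp

lemma constantCoeff_taylor (f : T) : constantCoeff (h.taylor f) = ε f := by
  rw [taylor_eq]
  simp

lemma X_pow_dvd_taylor_iff (n : ℕ) (f : T) : X ^ n ∣ h.taylor f ↔ t ^ n ∣ f := by
  constructor
  · intro hf
    induction n generalizing f with
    | zero => simp
    | succ n ih =>
      have h0 : ε f = 0 := by
        rw [← h.constantCoeff_taylor, ← X_dvd_iff]
        exact (dvd_pow_self X (Nat.succ_ne_zero n)).trans hf
      rw [taylor_eq, h0, map_zero, zero_add, pow_succ'] at hf
      rw [h.eq_add_mul_divDiff f, h0, map_zero, zero_add, pow_succ']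
      exact mul_dvd_mul_left t (ih _ ((mul_dvd_mul_iff_left X_ne_zero).mp hf))
  · rintro ⟨g, rfl⟩
    rw [map_mul, map_pow, taylor_self]
    exact dvd_mul_right _ _

end IsParameter

end Taylor

section BranchExpansion

open PowerSeries

variable {k S : Type u} [Field k] [CommRing S] [Algebra k S]

/-- At a maximal ideal `P` with residue field `k` that is locally generated by a non-zero-divisor,
`S` has a power series expansion that induces isomorphisms `S ⧸ P ^ n ≃ k[X] ⧸ (X ^ n)`. -/
lemma exists_branch_expansion (P : Ideal S) [P.IsMaximal] (ε : S →ₐ[k] k)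
    (hε : RingHom.ker ε = P) {p u : S} (hpP : p ∈ P) (hu : u ∉ P)
    (hup : ∀ a ∈ P, ∃ b, u * a = p * b)
    (hp : ∀ z, p * z = 0 → u * z = 0) :
    ∃ Φ : S →ₐ[k] k⟦X⟧, (∀ n s, X ^ n ∣ Φ s ↔ s ∈ P ^ n) ∧
      ∀ n g, ∃ s, X ^ n ∣ Φ s - g := by
  -- The expansion is the Taylor expansion in `p` of the localization at `P`.
  let T := Localization.AtPrime P
  have hunit : ∀ v : P.primeCompl, IsUnit ((ε : S →+* k) v) := by
    rintro ⟨v, hv⟩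
    rw [isUnit_iff_ne_zero]
    intro h0
    exact hv (hε ▸ (RingHom.mem_ker.mpr h0))
  let εT : T →+* k := IsLocalization.lift (M := P.primeCompl) hunit
  have hεT : ∀ s, εT (algebraMap S T s) = ε s := fun s => IsLocalization.lift_eq hunit s
  let εT' : T →ₐ[k] k :=
    { εT with
      commutes' := fun c => by
        change εT (algebraMap k T c) = c
        rw [IsScalarTower.algebraMap_apply k S T, hεT]
        simp }
  have huT : IsUnit (algebraMap S T u) := IsLocalization.map_units T (⟨u, hu⟩ : P.primeCompl)
  have hpar : IsParameter (algebraMap S T p) εT' := by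
    constructor
    · rw [mem_nonZeroDivisors_iff_right]
      intro z hz
      obtain ⟨⟨z, v⟩, rfl⟩ := IsLocalization.mk'_surjective P.primeCompl z
      rw [mul_comm, IsLocalization.mul_mk'_eq_mk'_of_mul, IsLocalization.mk'_eq_zero_iff] at hz
      obtain ⟨w, hw⟩ := hz
      rw [IsLocalization.mk'_eq_zero_iff]
      refine ⟨⟨u, hu⟩ * w, ?_⟩
      change u * w * z = 0
      rw [mul_assoc]
      exact hp _ (by rw [← hw]; ring)
    · ext z
      obtain ⟨z, v, rfl⟩ := IsLocalization.exists_mk'_eq P.primeCompl z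
      have hv : algebraMap S T v * IsLocalization.mk' T z v = algebraMap S T z := by
        rw [mul_comm]; exact IsLocalization.mk'_spec T z v
      have hvu : IsUnit (algebraMap S T v) := IsLocalization.map_units T v
      rw [Ideal.mem_span_singleton, RingHom.mem_ker]
      change εT _ = 0 ↔ _
      constructor
      · intro h0
        have hz : z ∈ P := by
          rw [← hε, RingHom.mem_ker]
          rw [← hεT z, ← hv, map_mul, h0, mul_zero]
        obtain ⟨b, hb⟩ := hup z hz
        rw [← hvu.dvd_mul_left, hv, ← huT.dvd_mul_left, ← map_mul, hb, map_mul]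
        exact dvd_mul_right _ _
      · rintro ⟨w, hw⟩
        have hp0 : ε p = 0 := RingHom.mem_ker.mp (hε.symm ▸ hpP)
        rw [hw, map_mul, hεT, hp0, zero_mul]
  have hmem : ∀ n s, algebraMap S T p ^ n ∣ algebraMap S T s ↔ s ∈ P ^ n := by
    intro n s
    constructor
    · rintro ⟨z, hz⟩
      obtain ⟨z, v, rfl⟩ := IsLocalization.exists_mk'_eq P.primeCompl z
      rw [← map_pow, IsLocalization.mul_mk'_eq_mk'_of_mul, IsLocalization.eq_mk'_iff_mul_eq,
        ← map_mul, IsLocalization.eq_iff_exists P.primeCompl] at hz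
      obtain ⟨w, hw⟩ := hz
      have hwv : (w * v : S) ∉ P := (w * v).2
      have hcop : IsCoprime (P ^ n) (Ideal.span {(w * v : S)}) := by
        refine IsCoprime.pow_left ?_
        rw [Ideal.isCoprime_iff_sup_eq]
        by_contra hne
        refine hwv ?_
        have h1 := Ideal.IsMaximal.eq_of_le ‹P.IsMaximal› hne le_sup_left
        exact h1.ge (Ideal.mem_sup_right (Ideal.mem_span_singleton_self _))
      obtain ⟨a, ha, b, hb, hab⟩ := Ideal.isCoprime_iff_exists.mp hcop
      obtain ⟨c, rfl⟩ := Ideal.mem_span_singleton'.mp hb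
      rw [← one_mul s, ← hab, add_mul]
      refine add_mem (Ideal.mul_mem_right _ _ ha) ?_
      have : c * (w * v : S) * s = p ^ n * (c * w * z) := by
        linear_combination c * hw
      rw [this]
      exact Ideal.mul_mem_right _ _ (Ideal.pow_mem_pow hpP n)
    · intro hs
      have hle : P.map (algebraMap S T) ≤ Ideal.span {algebraMap S T p} := by
        rw [Ideal.map_le_iff_le_comap]
        intro a ha
        obtain ⟨b, hb⟩ := hup a ha
        rw [Ideal.mem_comap, Ideal.mem_span_singleton, ← huT.dvd_mul_left, ← map_mul, hb, map_mul]
        exact dvd_mul_right _ _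
      have h1 := Ideal.mem_map_of_mem (algebraMap S T) hs
      rw [Ideal.map_pow] at h1
      have h2 := Ideal.pow_right_mono hle n h1
      rwa [Ideal.span_singleton_pow, Ideal.mem_span_singleton] at h2
  have hΦp : hpar.taylor (algebraMap S T p) = X := hpar.taylor_self
  refine ⟨hpar.taylor.comp (IsScalarTower.toAlgHom k S T),
    fun n s => (hpar.X_pow_dvd_taylor_iff n _).trans (hmem n s), fun n g => ?_⟩
  induction n with
  | zero => exact ⟨0, by simp⟩
  | succ n ih =>
    obtain ⟨s, q, hq⟩ := ih
    refine ⟨s - algebraMap k S (constantCoeff q) * p ^ n, ?_⟩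
    obtain ⟨q', hq'⟩ : X ∣ q - C (constantCoeff q) := by
      rw [X_dvd_iff]; simp
    refine ⟨q', ?_⟩
    have hΦ : (hpar.taylor.comp (IsScalarTower.toAlgHom k S T)) p = X := hΦp
    rw [map_sub, map_mul, map_pow, hΦ, AlgHom.commutes, pow_succ, mul_assoc, ← hq']
    change _ - C (constantCoeff q) * _ - _ = _
    linear_combination hq

end BranchExpansion

/-! ### The normalization of a one-dimensional local ring -/

section Normalization

variable {R : Type u} [CommRing R]

/-- An element `q` that multiplies an ideal `P` of a finite extension `S` of `R` into itself is
integral over `R`, if `P` contains a unit of the ambient ring `Q`. -/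
lemma isIntegral_of_mul_mem {S Q : Type u} [CommRing S] [CommRing Q] [Algebra R S] [Algebra S Q]
    [Algebra R Q] [IsScalarTower R S Q] [IsNoetherianRing R] [Module.Finite R S]
    (hinj : Function.Injective (algebraMap S Q)) {P : Ideal S} {x : S} (hxP : x ∈ P)
    (hx : IsUnit (algebraMap S Q x)) {q : Q}
    (hq : ∀ a ∈ P, ∃ b ∈ P, q * algebraMap S Q a = algebraMap S Q b) : IsIntegral R q := by
  have hq' : ∀ a : P, ∃ b : P, q * algebraMap S Q a = algebraMap S Q b := fun a => by
    obtain ⟨b, hb, h⟩ := hq a a.2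
    exact ⟨⟨b, hb⟩, h⟩
  choose f hf using hq'
  have hinj' : ∀ a b : P, algebraMap S Q a = algebraMap S Q b → a = b := fun a b h =>
    Subtype.ext (hinj h)
  let F : Module.End R P :=
    { toFun := f
      map_add' := fun a b => hinj' _ _ (by
        rw [← hf]
        simp only [Submodule.coe_add, map_add, mul_add, hf])
      map_smul' := fun r a => hinj' _ _ (by
        rw [← hf]
        simp only [RingHom.id_apply, Submodule.coe_smul_of_tower, Algebra.smul_def, map_mul]
        rw [mul_left_comm, hf]) }
  have hF : ∀ a : P, algebraMap S Q (F a) = q * algebraMap S Q a := fun a => (hf a).symm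
  have : Module.Finite R P := by
    have : IsNoetherian R S := inferInstance
    exact Module.Finite.iff_fg.mpr (this.noetherian (P.restrictScalars R))
  obtain ⟨χ, hχ, h0⟩ := LinearMap.exists_monic_and_aeval_eq_zero R F
  have hpow : ∀ (n : ℕ) (a : P), algebraMap S Q ((F ^ n) a : P) = q ^ n * algebraMap S Q a := by
    intro n
    induction n with
    | zero => simp
    | succ n ih =>
      intro a
      rw [pow_succ, Module.End.mul_apply, ih, hF]
      ring
  have key : algebraMap S Q ((Polynomial.aeval F χ) ⟨x, hxP⟩ : P) =
      Polynomial.aeval q χ * algebraMap S Q x := by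
    rw [Polynomial.aeval_eq_sum_range, Polynomial.aeval_eq_sum_range, LinearMap.sum_apply,
      Submodule.coe_sum, map_sum, Finset.sum_mul]
    refine Finset.sum_congr rfl fun i _ => ?_
    rw [LinearMap.smul_apply, Submodule.coe_smul_of_tower, Algebra.smul_def, map_mul, hpow,
      ← IsScalarTower.algebraMap_apply, Algebra.smul_def, mul_assoc]
  refine ⟨χ, hχ, ?_⟩
  rw [h0] at key
  simp only [LinearMap.zero_apply, ZeroMemClass.coe_zero, map_zero] at key
  exact (hx.mul_left_eq_zero).mp key.symm

/-- A non-zero-divisor lies in no minimal prime. -/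
lemma isMaximal_of_mem_nonZeroDivisors [Ring.KrullDimLE 1 R] {x : R} (hx : x ∈ nonZeroDivisors R)
    {I : Ideal R} (hI : I.IsPrime) (hxI : x ∈ I) : I.IsMaximal := by
  refine (Ring.krullDimLE_one_iff.mp inferInstance I hI).resolve_left fun h => ?_
  exact Set.disjoint_left.mp (Ideal.disjoint_nonZeroDivisors_of_mem_minimalPrimes h) hxI hx

lemma isFiniteLength_quotient_span [IsNoetherianRing R] [Ring.KrullDimLE 1 R] {x : R}
    (hx : x ∈ nonZeroDivisors R) : IsFiniteLength R (R ⧸ Ideal.span {x}) := by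
  have : Ring.KrullDimLE 0 (R ⧸ Ideal.span {x}) := by
    refine Ring.KrullDimLE.mk₀ fun I hI => ?_
    have h1 : (I.comap (Ideal.Quotient.mk (Ideal.span {x}))).IsMaximal := by
      refine isMaximal_of_mem_nonZeroDivisors hx (hI.comap _) ?_
      rw [Ideal.mem_comap, Ideal.Quotient.eq_zero_iff_mem.mpr (Ideal.mem_span_singleton_self x)]
      exact I.zero_mem
    have h2 := Ideal.map_eq_top_or_isMaximal_of_surjective (Ideal.Quotient.mk (Ideal.span {x}))
      Ideal.Quotient.mk_surjective h1
    rw [Ideal.map_comap_of_surjective _ Ideal.Quotient.mk_surjective] at h2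
    exact h2.resolve_left hI.ne_top
  have hart : IsArtinianRing (R ⧸ Ideal.span {x}) := isArtinianRing_iff_krullDimLE_zero.mpr this
  rw [isFiniteLength_iff_isNoetherian_isArtinian]
  refine ⟨inferInstance, ?_⟩
  exact isArtinian_of_surjective_algebraMap (M := R ⧸ Ideal.span {x}) (R := R ⧸ Ideal.span {x})
    (S := R) Ideal.Quotient.mk_surjective

lemma isUnit_algebraMap_fractionRing {x : R} (hx : x ∈ nonZeroDivisors R) :
    IsUnit (algebraMap (normalizationRing R) (FractionRing R)
      (algebraMap R (normalizationRing R) x)) := by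
  rw [← IsScalarTower.algebraMap_apply]
  exact IsLocalization.map_units (FractionRing R) ⟨x, hx⟩

lemma algebraMap_normalizationRing_injective :
    Function.Injective (algebraMap R (normalizationRing R)) := by
  have h := IsFractionRing.injective R (FractionRing R)
  rw [IsScalarTower.algebraMap_eq R (normalizationRing R) (FractionRing R), RingHom.coe_comp] at h
  exact h.of_comp

lemma mul_eq_zero_of_nonZeroDivisors {x : R} (hx : x ∈ nonZeroDivisors R)
    {z : normalizationRing R} (h : algebraMap R (normalizationRing R) x * z = 0) : z = 0 := by
  apply Subtype.val_injective
  have h1 : algebraMap (normalizationRing R) (FractionRing R)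
      (algebraMap R (normalizationRing R) x) * (z : FractionRing R) = 0 := by
    have := congrArg (algebraMap (normalizationRing R) (FractionRing R)) h
    rwa [map_mul, map_zero] at this
  exact ((isUnit_algebraMap_fractionRing hx).mul_right_eq_zero).mp h1

lemma isMaximal_of_comap_eq [IsLocalRing R] {P : Ideal (normalizationRing R)} [P.IsPrime]
    (hP : P.comap (algebraMap R (normalizationRing R)) = maximalIdeal R) : P.IsMaximal := by
  have : (P.comap (algebraMap R (normalizationRing R))).IsMaximal := by
    rw [hP]; infer_instance
  exact Ideal.isMaximal_of_isIntegral_of_isMaximal_comap P this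

/-- The points of the normalization of a one-dimensional local ring are regular: the maximal
ideals of `R̃` are locally generated by one non-zero-divisor. Such an ideal `P` is the annihilator
of an element `y` modulo `x`, and the fraction `q = y / x` satisfies `q P ⊄ P`, as it is not
integral; an element `p` of `P` with `q p ∉ P` is a local generator. -/
lemma exists_local_generator [IsLocalRing R] [IsNoetherianRing R] [Ring.KrullDimLE 1 R]
    [Module.Finite R (normalizationRing R)] {x : R} (hx : x ∈ nonZeroDivisors R)
    (hxm : x ∈ maximalIdeal R) {P : Ideal (normalizationRing R)} [P.IsPrime]
    (hP : P.comap (algebraMap R (normalizationRing R)) = maximalIdeal R) :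
    ∃ p ∈ P, ∃ u ∉ P, (∀ a ∈ P, ∃ b, u * a = p * b) ∧ ∀ z, p * z = 0 → u * z = 0 := by
  have : IsNoetherianRing (normalizationRing R) := IsNoetherianRing.of_finite R _
  set x' : normalizationRing R := algebraMap R (normalizationRing R) x
  have hx'P : x' ∈ P := by
    rw [← Ideal.mem_comap, hP]
    exact hxm
  have hmin : P ∈ (Ideal.span {x'}).minimalPrimes := by
    refine ⟨⟨inferInstance, (Ideal.span_singleton_le_iff_mem P).mpr hx'P⟩, ?_⟩
    rintro P' ⟨hP', hx'⟩ hle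
    rw [Ideal.span_singleton_le_iff_mem] at hx'
    have h1 : (P'.comap (algebraMap R (normalizationRing R))).IsMaximal :=
      isMaximal_of_mem_nonZeroDivisors hx (hP'.comap _) hx'
    have h2 : P'.IsMaximal := Ideal.isMaximal_of_isIntegral_of_isMaximal_comap P' h1
    exact (h2.eq_of_le (Ideal.IsPrime.ne_top inferInstance) hle).ge
  obtain ⟨y, hy⟩ : ∃ y : normalizationRing R, P = (Ideal.span {x'}).colon {y} := by
    refine Submodule.exists_eq_colon_of_mem_minimalPrimes (x := (1 : normalizationRing R)) ?_
    have : (Ideal.span {x'}).colon {(1 : normalizationRing R)} = Ideal.span {x'} := by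
      ext a
      simp [Submodule.mem_colon_singleton]
    rwa [this]
  have hmem : ∀ a, a ∈ P ↔ ∃ b, a * y = x' * b := fun a => by
    rw [hy, Submodule.mem_colon_singleton, smul_eq_mul, Ideal.mem_span_singleton]
    rfl
  have hcancel : ∀ z : normalizationRing R, x' * z = 0 → z = 0 := fun z =>
    mul_eq_zero_of_nonZeroDivisors hx
  obtain ⟨p, hp, u, hu, hpu⟩ : ∃ p ∈ P, ∃ u ∉ P, p * y = x' * u := by
    by_contra! hcon
    have hxu := isUnit_algebraMap_fractionRing hx
    obtain ⟨v, hv⟩ := hxu.exists_right_inv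
    have hint : IsIntegral R ((y : FractionRing R) * v) := by
      refine isIntegral_of_mul_mem (S := normalizationRing R) Subtype.val_injective hx'P hxu
        fun a ha => ?_
      obtain ⟨b, hb⟩ := (hmem a).mp ha
      refine ⟨b, by_contra fun hbP => hcon a ha b hbP hb, ?_⟩
      have hb' : (a : FractionRing R) * y = x' * b := congrArg Subtype.val hb
      change (y : FractionRing R) * v * a = b
      change (x' : FractionRing R) * v = 1 at hv
      linear_combination v * hb' + b * hv
    have h1 : (1 : normalizationRing R) ∈ P := by
      refine (hmem 1).mpr ⟨⟨(y : FractionRing R) * v, hint⟩, Subtype.ext ?_⟩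
      change (1 : FractionRing R) * y = x' * (y * v)
      change (x' : FractionRing R) * v = 1 at hv
      linear_combination (-(y : FractionRing R)) * hv
    exact Ideal.IsPrime.ne_top inferInstance ((Ideal.eq_top_iff_one P).mpr h1)
  refine ⟨p, hp, u, hu, fun a ha => ?_, fun z hz => ?_⟩
  · obtain ⟨b, hb⟩ := (hmem a).mp ha
    refine ⟨b, ?_⟩
    rw [← sub_eq_zero]
    apply hcancel
    linear_combination p * hb - a * hpu
  · apply hcancel
    linear_combination y * hz - z * hpu

end Normalization

/-! ### Extensions with finite-dimensional cokernel -/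

section FiniteQuotient

variable {k R S : Type u} [Field k] [CommRing R] [CommRing S] [Algebra k R] [Algebra R S]
  [Algebra k S] [IsScalarTower k R S]

/-- A nonzero `R`-module that is finite-dimensional over `k` has a quotient that is a vector space
over the residue field of `R`; thus the residue field is a finite extension of `k`. -/
lemma exists_residue_algHom [IsAlgClosed k] [IsLocalRing R] {V : Type u} [AddCommGroup V]
    [Module R V] [Module k V] [IsScalarTower k R V] [Module.Finite k V] [Nontrivial V] :
    ∃ ρ : R →ₐ[k] k, RingHom.ker ρ = maximalIdeal R := by
  have hfin : Module.Finite R V := Module.Finite.of_restrictScalars_finite k R V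
  have hne : maximalIdeal R • (⊤ : Submodule R V) ≠ ⊤ := fun h => by
    have := Submodule.eq_bot_of_le_smul_of_le_jacobson_bot (maximalIdeal R) (⊤ : Submodule R V)
      hfin.fg_top h.ge (IsLocalRing.maximalIdeal_le_jacobson _)
    exact (bot_ne_top (α := Submodule R V)) this.symm
  obtain ⟨v, hv⟩ : ∃ v, v ∉ maximalIdeal R • (⊤ : Submodule R V) := by
    by_contra! h
    exact hne (eq_top_iff.mpr fun v _ => h v)
  let W := V ⧸ maximalIdeal R • (⊤ : Submodule R V)
  let f : R →ₗ[R] W := LinearMap.toSpanSingleton R W (Submodule.Quotient.mk v)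
  have hker : LinearMap.ker f = maximalIdeal R := by
    refine (IsLocalRing.maximalIdeal.isMaximal R).eq_of_le ?_ ?_ |>.symm
    · intro h
      have h1 : (1 : R) ∈ LinearMap.ker f := h ▸ Submodule.mem_top
      rw [LinearMap.mem_ker, LinearMap.toSpanSingleton_apply, one_smul,
        Submodule.Quotient.mk_eq_zero] at h1
      exact hv h1
    · intro r hr
      rw [LinearMap.mem_ker, LinearMap.toSpanSingleton_apply, ← Submodule.Quotient.mk_smul,
        Submodule.Quotient.mk_eq_zero]
      exact Submodule.smul_mem_smul hr Submodule.mem_top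
  have hfd : Module.Finite k (R ⧸ maximalIdeal R) := by
    rw [← hker]
    exact Module.Finite.of_injective ((Submodule.liftQ _ f le_rfl).restrictScalars k)
      (LinearMap.ker_eq_bot (f := Submodule.liftQ _ f le_rfl) |>.mp
        (Submodule.ker_liftQ_eq_bot' _ f rfl))
  have hbij : Function.Bijective (algebraMap k (R ⧸ maximalIdeal R)) :=
    IsAlgClosed.algebraMap_bijective_of_isIntegral
  let e : k ≃ₐ[k] (R ⧸ maximalIdeal R) := AlgEquiv.ofBijective (Algebra.ofId k _) hbij
  refine ⟨(e.symm : _ →ₐ[k] k).comp (Ideal.Quotient.mkₐ k (maximalIdeal R)), ?_⟩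
  ext r
  rw [RingHom.mem_ker]
  change e.symm (Ideal.Quotient.mk (maximalIdeal R) r) = 0 ↔ _
  rw [map_eq_zero_iff _ e.symm.injective, Ideal.Quotient.eq_zero_iff_mem]

lemma finite_of_finite_quotient_range
    [Module.Finite k (S ⧸ LinearMap.range (Algebra.linearMap R S))] : Module.Finite R S := by
  have : Module.Finite R (S ⧸ LinearMap.range (Algebra.linearMap R S)) :=
    Module.Finite.of_restrictScalars_finite k R _
  exact Module.Finite.of_submodule_quotient (LinearMap.range (Algebra.linearMap R S))

/-- The points of `S` over the closed point of `R` are `k`-rational. -/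
lemma exists_algHom_ker_eq [IsAlgClosed k] [IsLocalRing R] [Algebra.IsIntegral R S]
    {ρ : R →ₐ[k] k} (hρ : RingHom.ker ρ = maximalIdeal R) {P : Ideal S} [P.IsPrime]
    (hP : P.comap (algebraMap R S) = maximalIdeal R) : ∃ ε : S →ₐ[k] k, RingHom.ker ε = P := by
  have hcomp : (algebraMap k (S ⧸ P)).comp (ρ : R →+* k) = algebraMap R (S ⧸ P) := by
    ext r
    have h1 : r - algebraMap k R (ρ r) ∈ maximalIdeal R := by
      rw [← hρ, RingHom.mem_ker]
      simp
    rw [← hP, Ideal.mem_comap, map_sub, ← IsScalarTower.algebraMap_apply,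
      ← Ideal.Quotient.eq_zero_iff_mem, map_sub, sub_eq_zero] at h1
    exact h1.symm
  have hint : Algebra.IsIntegral k (S ⧸ P) := by
    refine ⟨fun s => ?_⟩
    obtain ⟨s, rfl⟩ := Ideal.Quotient.mk_surjective s
    obtain ⟨χ, hχ, h0⟩ := Algebra.IsIntegral.isIntegral (R := R) s
    refine ⟨χ.map (ρ : R →+* k), hχ.map _, ?_⟩
    rw [Polynomial.eval₂_map, hcomp]
    have := congrArg (Ideal.Quotient.mk P) h0
    rw [Polynomial.hom_eval₂, map_zero] at this
    exact this
  have hbij : Function.Bijective (algebraMap k (S ⧸ P)) :=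
    IsAlgClosed.algebraMap_bijective_of_isIntegral
  let e : k ≃ₐ[k] (S ⧸ P) := AlgEquiv.ofBijective (Algebra.ofId k _) hbij
  refine ⟨(e.symm : _ →ₐ[k] k).comp (Ideal.Quotient.mkₐ k P), ?_⟩
  ext r
  rw [RingHom.mem_ker]
  change e.symm (Ideal.Quotient.mk P r) = 0 ↔ _
  rw [map_eq_zero_iff _ e.symm.injective, Ideal.Quotient.eq_zero_iff_mem]

/-- A power of the maximal ideal annihilates a module that is finite-dimensional over `k`. -/
lemma exists_pow_smul_top_eq_bot [IsLocalRing R] {V : Type u} [AddCommGroup V]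
    [Module R V] [Module k V] [IsScalarTower k R V] [Module.Finite k V] :
    ∃ e : ℕ, maximalIdeal R ^ e • (⊤ : Submodule R V) = ⊥ := by
  have : IsArtinian R V := isArtinian_of_tower k inferInstance
  have : IsNoetherian R V := isNoetherian_of_tower k inferInstance
  let f : ℕ →o (Submodule R V)ᵒᵈ :=
    ⟨fun e => OrderDual.toDual (maximalIdeal R ^ e • (⊤ : Submodule R V)), fun a b hab =>
      Submodule.smul_mono_left (Ideal.pow_le_pow_right hab)⟩
  obtain ⟨e, he⟩ := IsArtinian.monotone_stabilizes f
  refine ⟨e, ?_⟩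
  refine Submodule.eq_bot_of_le_smul_of_le_jacobson_bot (maximalIdeal R) _
    (IsNoetherian.noetherian _) ?_ (IsLocalRing.maximalIdeal_le_jacobson _)
  have h1 : maximalIdeal R ^ e • (⊤ : Submodule R V) =
      maximalIdeal R ^ (e + 1) • (⊤ : Submodule R V) := he (e + 1) (Nat.le_succ e)
  rw [← smul_assoc, smul_eq_mul, ← pow_succ', ← h1]

/-- `R` contains a power of the intersection of the points of `S` over the closed point. -/
lemma exists_pow_le_range [IsLocalRing R] [IsNoetherianRing S] {J : Ideal S}
    [Module.Finite k (S ⧸ LinearMap.range (Algebra.linearMap R S))]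
    (hJ : ∀ P : Ideal S, P.IsPrime → P.comap (algebraMap R S) = maximalIdeal R → J ≤ P) :
    ∃ N, ∀ s ∈ J ^ N, s ∈ LinearMap.range (Algebra.linearMap R S) := by
  have hrad : J ≤ ((maximalIdeal R).map (algebraMap R S)).radical := by
    rw [Ideal.radical_eq_sInf]
    refine le_sInf fun P ⟨hle, hP⟩ => hJ P hP ?_
    rw [Ideal.map_le_iff_le_comap] at hle
    exact ((IsLocalRing.maximalIdeal.isMaximal R).eq_of_le (hP.comap _).ne_top hle).symm
  obtain ⟨c, hc⟩ := Ideal.exists_radical_pow_le_of_fg ((maximalIdeal R).map (algebraMap R S))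
    (IsNoetherian.noetherian _)
  obtain ⟨e, he⟩ := exists_pow_smul_top_eq_bot (k := k) (R := R)
    (V := S ⧸ LinearMap.range (Algebra.linearMap R S))
  refine ⟨c * e, fun s hs => ?_⟩
  have h1 : s ∈ (maximalIdeal R ^ e).map (algebraMap R S) := by
    rw [Ideal.map_pow]
    rw [pow_mul] at hs
    exact Ideal.pow_right_mono ((Ideal.pow_right_mono hrad c).trans hc) e hs
  rw [Ideal.map] at h1
  suffices H : ∀ t, t * s ∈ LinearMap.range (Algebra.linearMap R S) by
    simpa using H 1
  refine Submodule.span_induction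
    (p := fun s _ => ∀ t, t * s ∈ LinearMap.range (Algebra.linearMap R S)) ?_ ?_ ?_ ?_ h1
  · rintro _ ⟨a, ha, rfl⟩ t
    rw [← Submodule.Quotient.mk_eq_zero, mul_comm, ← Algebra.smul_def, Submodule.Quotient.mk_smul,
      ← Submodule.mem_bot R, ← he]
    exact Submodule.smul_mem_smul ha Submodule.mem_top
  · intro t
    rw [mul_zero]
    exact zero_mem _
  · intro x y _ _ hx hy t
    rw [mul_add]
    exact add_mem (hx t) (hy t)
  · intro a x _ hx t
    rw [smul_eq_mul, ← mul_assoc]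
    exact hx _

end FiniteQuotient

/-! ### Independence of the expansions at distinct points -/

section ChineseRemainder

open PowerSeries Function

variable {k S : Type u} [Field k] [CommRing S] [Algebra k S] {ι : Type u} [Finite ι]

/-- Expansions at finitely many distinct maximal ideals can be approximated independently. -/
lemma exists_forall_X_pow_dvd_sub {P : ι → Ideal S} (hP : Pairwise (IsCoprime on P))
    {Φ : ι → S →ₐ[k] k⟦X⟧} (hΦ : ∀ i n s, X ^ n ∣ Φ i s ↔ s ∈ P i ^ n)
    (hsurj : ∀ i n g, ∃ s, X ^ n ∣ Φ i s - g) (n : ℕ) (g : ι → k⟦X⟧) :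
    ∃ s, ∀ i, X ^ n ∣ Φ i s - g i := by
  choose t ht using fun i => hsurj i n (g i)
  obtain ⟨s, hs⟩ := Ideal.exists_forall_sub_mem_ideal (I := fun i => P i ^ n)
    (fun i j hij => IsCoprime.pow (hP hij)) t
  refine ⟨s, fun i => ?_⟩
  have h1 := (hΦ i n _).mpr (hs i)
  rw [map_sub] at h1
  have := dvd_add h1 (ht i)
  rwa [sub_add_sub_cancel] at this

lemma mem_iInf_pow_iff {P : ι → Ideal S} (hP : Pairwise (IsCoprime on P)) (n : ℕ) (s : S) :
    s ∈ (⨅ i, P i) ^ n ↔ ∀ i, s ∈ P i ^ n := by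
  constructor
  · intro hs i
    exact Ideal.pow_right_mono (iInf_le P i) n hs
  · intro hs
    have := Fintype.ofFinite ι
    have h1 : ∏ i, P i = ⨅ i, P i := by
      simpa using Ideal.prod_eq_iInf_of_pairwise_isCoprime (s := Finset.univ) (J := P)
        (fun i _ j _ hij => hP hij)
    have h2 : ∏ i, P i ^ n = ⨅ i, P i ^ n := by
      simpa using Ideal.prod_eq_iInf_of_pairwise_isCoprime (s := Finset.univ)
        (J := fun i => P i ^ n) (fun i _ j _ hij => IsCoprime.pow (hP hij))
    rw [← h1, ← Finset.prod_pow, h2]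
    exact (Submodule.mem_iInf _).mpr hs

end ChineseRemainder

/-! ### The local ring of genus one inside its normalization -/

section GenusOne

open PowerSeries

variable {k S : Type u} [Field k] [CommRing S] [Algebra k S] {ι : Type*}

/-- A family `Φ` of power series expansions on a `k`-algebra `S` that identifies the completion
of `S` along an ideal `J` with a product of power series rings. -/
structure IsBranchExpansion (J : Ideal S) (Φ : ι → S →ₐ[k] k⟦X⟧) : Prop where
  mem_pow_iff : ∀ n s, s ∈ J ^ n ↔ ∀ i, X ^ n ∣ Φ i s
  approx : ∀ (n : ℕ) (g : ι → k⟦X⟧), ∃ s, ∀ i, X ^ n ∣ Φ i s - g i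

/-- A `k`-subalgebra of `S` that has a single `k`-rational point along `J` and that contains a
power of `J`. -/
structure IsGluing (J : Ideal S) (B : Subalgebra k S) : Prop where
  residue : ∀ b ∈ B, ∃ c : k, b - algebraMap k S c ∈ J
  conductor : ∃ N, ∀ s ∈ J ^ N, s ∈ B

/-- If `B` contains all but one dimension of `J`, then it contains `J ^ 2`. Otherwise
`J ⊆ (B ∩ J) + J ^ 2`, hence `J ⊆ (B ∩ J) + J ^ n` for all `n`, and `J ⊆ B`. -/
lemma IsGluing.sq_le {J : Ideal S} {B : Subalgebra k S} (hB : IsGluing J B) {y : S}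
    (hyJ : y ∈ J) (hyB : y ∉ B) (hy : ∀ j ∈ J, ∃ c : k, j - c • y ∈ B) : ∀ z ∈ J ^ 2, z ∈ B := by
  intro z hz
  by_contra hzB
  have hzJ : z ∈ J := Ideal.pow_le_self two_ne_zero hz
  obtain ⟨l, hl⟩ := hy z hzJ
  have hl0 : l ≠ 0 := by
    rintro rfl
    rw [zero_smul, sub_zero] at hl
    exact hzB hl
  have h2 : ∀ j ∈ J, ∃ b ∈ B, b ∈ J ∧ j - b ∈ J ^ 2 := by
    intro j hj
    obtain ⟨c, hc⟩ := hy j hj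
    have hmem : (c * l⁻¹) • z ∈ J ^ 2 := Submodule.smul_of_tower_mem _ _ hz
    refine ⟨j - (c * l⁻¹) • z, ?_, sub_mem hj (Submodule.smul_of_tower_mem _ _ hzJ), ?_⟩
    · have : j - (c * l⁻¹) • z = (j - c • y) - (c * l⁻¹) • (z - l • y) := by
        rw [smul_sub, smul_smul, inv_mul_cancel_right₀ hl0]
        abel
      rw [this]
      exact sub_mem hc (B.smul_mem hl _)
    · rwa [sub_sub_cancel]
  have hn : ∀ n, ∀ j ∈ J, ∃ b ∈ B, b ∈ J ∧ j - b ∈ J ^ (n + 2) := by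
    intro n
    induction n with
    | zero => exact h2
    | succ n ih =>
      have hsq : ∀ j ∈ J ^ 2, ∃ b ∈ B, b ∈ J ∧ j - b ∈ J ^ (n + 3) := by
        intro j hj
        rw [pow_two] at hj
        refine Submodule.mul_induction_on hj ?_ ?_
        · intro p hp q hq
          obtain ⟨b, hb, hbJ, hpb⟩ := ih p hp
          obtain ⟨d, hd, hdJ, hqd⟩ := ih q hq
          refine ⟨b * d, mul_mem hb hd, J.mul_mem_left _ hdJ, ?_⟩
          have : p * q - b * d = (p - b) * q + (q - d) * b := by ring
          rw [this]
          exact add_mem (by simpa [pow_succ] using Ideal.mul_mem_mul hpb hq)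
            (by simpa [pow_succ] using Ideal.mul_mem_mul hqd hbJ)
        · rintro p q ⟨b, hb, hbJ, hpb⟩ ⟨d, hd, hdJ, hqd⟩
          refine ⟨b + d, add_mem hb hd, add_mem hbJ hdJ, ?_⟩
          rw [add_sub_add_comm]
          exact add_mem hpb hqd
      intro j hj
      obtain ⟨b, hb, hbJ, hjb⟩ := h2 j hj
      obtain ⟨d, hd, hdJ, hjd⟩ := hsq _ hjb
      refine ⟨b + d, add_mem hb hd, add_mem hbJ hdJ, ?_⟩
      rwa [← sub_sub]
  obtain ⟨N, hN⟩ := hB.conductor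
  obtain ⟨b, hb, -, hyb⟩ := hn N y hyJ
  have := add_mem (hN _ (Ideal.pow_le_pow_right (by omega) hyb)) hb
  rw [sub_add_cancel] at this
  exact hyB this

namespace IsBranchExpansion

variable {J : Ideal S} {Φ : ι → S →ₐ[k] k⟦X⟧} (hΦ : IsBranchExpansion J Φ)
include hΦ

lemma mem_iff (s : S) : s ∈ J ↔ ∀ i, constantCoeff (Φ i s) = 0 := by
  simpa [X_dvd_iff] using hΦ.mem_pow_iff 1 s

lemma mem_sq_iff (s : S) :
    s ∈ J ^ 2 ↔ ∀ i, constantCoeff (Φ i s) = 0 ∧ coeff 1 (Φ i s) = 0 := by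
  rw [hΦ.mem_pow_iff]
  refine forall_congr' fun i => ?_
  rw [X_pow_dvd_iff]
  constructor
  · exact fun h => ⟨by simpa using h 0 (by norm_num), h 1 (by norm_num)⟩
  · rintro ⟨h0, h1⟩ m hm
    interval_cases m
    · simpa using h0
    · exact h1

lemma exists_constantCoeff_coeff_one (c d : ι → k) :
    ∃ s, ∀ i, constantCoeff (Φ i s) = c i ∧ coeff 1 (Φ i s) = d i := by
  obtain ⟨s, hs⟩ := hΦ.approx 2 fun i => C (c i) + C (d i) * X
  refine ⟨s, fun i => ?_⟩
  have h := X_pow_dvd_iff.mp (hs i)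
  have h0 := h 0 (by norm_num)
  have h1 := h 1 (by norm_num)
  rw [map_sub, sub_eq_zero] at h0 h1
  constructor
  · simpa using h0
  · rw [h1, map_add, coeff_C_mul, coeff_one_X, coeff_C]
    simp

variable [Fintype ι]

/-- If the codimension of `B` in `S` equals the number of branches, then `B` contains all but one
dimension of `J`. -/
lemma exists_generator_mod {B : Subalgebra k S} (hB : IsGluing J B) [Nonempty ι]
    [Module.Finite k (S ⧸ Subalgebra.toSubmodule B)]
    (hrank : Module.finrank k (S ⧸ Subalgebra.toSubmodule B) = Fintype.card ι) :
    ∃ y ∈ J, y ∉ B ∧ ∀ j ∈ J, ∃ c : k, j - c • y ∈ B := by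
  let c : S →ₗ[k] (ι → k) := LinearMap.pi fun i =>
    { toFun := fun s => constantCoeff (Φ i s)
      map_add' := by simp
      map_smul' := by simp }
  have hc : ∀ s i, c s i = constantCoeff (Φ i s) := fun _ _ => rfl
  let D : Submodule k (ι → k) := Submodule.span k {1}
  have hD : Module.finrank k D = 1 := finrank_span_singleton one_ne_zero
  have hle : Subalgebra.toSubmodule B ≤ D.comap c := by
    intro b hb
    obtain ⟨a, ha⟩ := hB.residue b hb
    rw [hΦ.mem_iff] at ha
    rw [Submodule.mem_comap, Submodule.mem_span_singleton]
    refine ⟨a, funext fun i => ?_⟩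
    have := ha i
    rw [map_sub, map_sub, sub_eq_zero, AlgHom.commutes] at this
    rw [hc, this]
    simp
  let F := Submodule.mapQ _ D c hle
  have hsurj : Function.Surjective F := by
    intro w
    obtain ⟨w, rfl⟩ := Submodule.mkQ_surjective _ w
    obtain ⟨s, hs⟩ := hΦ.exists_constantCoeff_coeff_one w 0
    refine ⟨Submodule.Quotient.mk s, ?_⟩
    have : c s = w := funext fun i => (hs i).1
    change Submodule.Quotient.mk (c s) = _
    rw [this]
    rfl
  have hker : Module.finrank k (LinearMap.ker F) = 1 := by
    have h1 := F.finrank_range_add_finrank_ker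
    have h2 := D.finrank_quotient_add_finrank
    rw [LinearMap.range_eq_top.mpr hsurj, finrank_top, hrank] at h1
    rw [Module.finrank_fintype_fun_eq_card] at h2
    omega
  obtain ⟨⟨v, hv⟩, hv0, hspan⟩ := finrank_eq_one_iff'.mp hker
  obtain ⟨s, rfl⟩ := Submodule.Quotient.mk_surjective _ v
  have hs : c s ∈ D := by
    rw [LinearMap.mem_ker] at hv
    change Submodule.Quotient.mk (c s) = 0 at hv
    rwa [Submodule.Quotient.mk_eq_zero] at hv
  obtain ⟨a, ha⟩ := Submodule.mem_span_singleton.mp hs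
  have hmk : ∀ z : S, (Submodule.Quotient.mk (z - algebraMap k S a) :
      S ⧸ Subalgebra.toSubmodule B) = Submodule.Quotient.mk z := fun z => by
    rw [Submodule.Quotient.eq, sub_sub_cancel_left]
    exact neg_mem (B.algebraMap_mem a)
  refine ⟨s - algebraMap k S a, ?_, ?_, ?_⟩
  · rw [hΦ.mem_iff]
    intro i
    have := congrFun ha i
    rw [hc] at this
    rw [map_sub, map_sub, ← this, AlgHom.commutes]
    simp
  · intro h
    apply hv0
    apply Subtype.ext
    change Submodule.Quotient.mk s = 0
    rw [← hmk, Submodule.Quotient.mk_eq_zero]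
    exact h
  · intro j hj
    have hjF : (Submodule.Quotient.mk j : S ⧸ Subalgebra.toSubmodule B) ∈ LinearMap.ker F := by
      rw [LinearMap.mem_ker]
      change Submodule.Quotient.mk (c j) = 0
      have : c j = 0 := funext fun i => (hΦ.mem_iff j).mp hj i
      rw [this, Submodule.Quotient.mk_zero]
    obtain ⟨b, hb⟩ := hspan ⟨_, hjF⟩
    have hb' : b • (Submodule.Quotient.mk s : S ⧸ Subalgebra.toSubmodule B)
        = Submodule.Quotient.mk j := congrArg Subtype.val hb
    rw [← hmk s, ← Submodule.Quotient.mk_smul, eq_comm, Submodule.Quotient.eq] at hb'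
    exact ⟨b, hb'⟩

/-- A subalgebra that contains all but one dimension of `J` is cut out in `S` by the equality of
the values on the branches and by one linear equation on the tangent vectors, because it contains
`J ^ 2`. -/
theorem exists_forall_mem_iff {B : Subalgebra k S} (hB : IsGluing J B) {y : S} (hyJ : y ∈ J)
    (hyB : y ∉ B) (hy : ∀ j ∈ J, ∃ c : k, j - c • y ∈ B) :
    ∃ a : ι → k, (∃ i, a i ≠ 0) ∧ ∀ s, s ∈ B ↔
      (∃ c, ∀ i, constantCoeff (Φ i s) = c) ∧ ∑ i, a i * coeff 1 (Φ i s) = 0 := by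
  classical
  have hsq := hB.sq_le hyJ hyB hy
  choose e he using fun i => hΦ.exists_constantCoeff_coeff_one 0 (Pi.single i 1)
  have heJ : ∀ i, e i ∈ J := fun i => (hΦ.mem_iff _).mpr fun j => (he i j).1
  choose a ha using fun i => hy (e i) (heJ i)
  have key : ∀ s ∈ J, s - (∑ i, a i * coeff 1 (Φ i s)) • y ∈ B := by
    intro s hs
    have h1 : s - ∑ i, coeff 1 (Φ i s) • e i ∈ J ^ 2 := by
      rw [hΦ.mem_sq_iff]
      intro i
      constructor
      · have h2 : s - ∑ i, coeff 1 (Φ i s) • e i ∈ J :=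
          sub_mem hs (sum_mem fun i _ => Submodule.smul_of_tower_mem _ _ (heJ i))
        exact (hΦ.mem_iff _).mp h2 i
      · simp only [map_sub, map_sum, map_smul, (he _ i).2, Pi.single_apply]
        simp
    have h3 : s - (∑ i, a i * coeff 1 (Φ i s)) • y = (s - ∑ i, coeff 1 (Φ i s) • e i) +
        ∑ i, coeff 1 (Φ i s) • (e i - a i • y) := by
      simp only [smul_sub, Finset.sum_sub_distrib, Finset.sum_smul, smul_smul, mul_comm (a _)]
      abel
    rw [h3]
    exact add_mem (hsq _ h1) (sum_mem fun i _ => B.smul_mem (ha i) _)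
  have key' : ∀ s ∈ J, s ∈ B ↔ ∑ i, a i * coeff 1 (Φ i s) = 0 := by
    intro s hs
    constructor
    · intro hsB
      by_contra h0
      have h1 := sub_mem hsB (key s hs)
      rw [sub_sub_cancel] at h1
      have h2 := B.smul_mem h1 (∑ i, a i * coeff 1 (Φ i s))⁻¹
      rw [inv_smul_smul₀ h0] at h2
      exact hyB h2
    · intro h0
      have := key s hs
      rwa [h0, zero_smul, sub_zero] at this
  refine ⟨a, ?_, fun s => ?_⟩
  · by_contra! h
    exact hyB ((key' y hyJ).mpr (by simp [h]))
  · have hcoeff : ∀ (c : k) i, coeff 1 (Φ i (s - algebraMap k S c)) = coeff 1 (Φ i s) := by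
      intro c i
      rw [map_sub, AlgHom.commutes, map_sub, PowerSeries.algebraMap_apply, coeff_C]
      simp
    have hconst : ∀ (c : k) i,
        constantCoeff (Φ i (s - algebraMap k S c)) = constantCoeff (Φ i s) - c := by
      intro c i
      rw [map_sub, AlgHom.commutes, map_sub, PowerSeries.algebraMap_apply]
      simp
    constructor
    · intro hs
      obtain ⟨c, hc⟩ := hB.residue s hs
      have h1 := (key' _ hc).mp (sub_mem hs (B.algebraMap_mem c))
      simp only [hcoeff] at h1
      refine ⟨⟨c, fun i => ?_⟩, h1⟩
      have := (hΦ.mem_iff _).mp hc i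
      rwa [hconst, sub_eq_zero] at this
    · rintro ⟨⟨c, hc⟩, h⟩
      have h1 : s - algebraMap k S c ∈ J := by
        rw [hΦ.mem_iff]
        intro i
        rw [hconst, hc, sub_self]
      have h2 := (key' _ h1).mpr (by simpa only [hcoeff] using h)
      have := add_mem h2 (B.algebraMap_mem c)
      rwa [sub_add_cancel] at this

/-- If the module `{q ∈ S | q (B ∩ J) ⊆ B} ⧸ B` is generated by each of its nonzero elements, as it
is for a Gorenstein ring, then every branch occurs in the linear equation. Otherwise that module
contains the classes of `y` and of an element `e` that is, modulo `J ^ 2`, the idempotent of the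
missing branch; but the multiples of `e` in it are scalar multiples, and no `y - d e` with `d` a
scalar lies in `B`. -/
theorem coefficient_ne_zero {B : Subalgebra k S} (hB : IsGluing J B) {y : S} (hyJ : y ∈ J)
    (hyB : y ∉ B) (hy : ∀ j ∈ J, ∃ c : k, j - c • y ∈ B)
    (htype : ∀ q₁ q₂ : S, q₁ ∉ B → (∀ b ∈ B, b ∈ J → q₁ * b ∈ B) → (∀ b ∈ B, b ∈ J → q₂ * b ∈ B) →
      ∃ b ∈ B, q₂ - b * q₁ ∈ B)
    {a : ι → k} (ha : ∃ i, a i ≠ 0) (hmem : ∀ s, s ∈ B ↔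
      (∃ c, ∀ i, constantCoeff (Φ i s) = c) ∧ ∑ i, a i * coeff 1 (Φ i s) = 0) (i : ι) :
    a i ≠ 0 := by
  classical
  intro hi
  obtain ⟨i', hi'⟩ := ha
  have hne : i' ≠ i := fun h => hi' (h ▸ hi)
  obtain ⟨e, he⟩ := hΦ.exists_constantCoeff_coeff_one (Pi.single i 1) 0
  have hcoeff : ∀ b ∈ J, ∀ j,
      coeff 1 (Φ j (e * b)) = (Pi.single i 1 : ι → k) j * coeff 1 (Φ j b) := by
    intro b hb j
    rw [map_mul, coeff_mul, Finset.Nat.antidiagonal_succ]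
    simp [(he j).1, (he j).2, (hΦ.mem_iff b).mp hb j]
  have heB : ∀ b ∈ B, b ∈ J → e * b ∈ B := by
    intro b _ hbJ
    rw [hmem]
    refine ⟨⟨0, fun j => (hΦ.mem_iff _).mp (J.mul_mem_left e hbJ) j⟩, ?_⟩
    refine Finset.sum_eq_zero fun j _ => ?_
    rw [hcoeff b hbJ]
    by_cases hj : j = i
    · rw [hj, hi, zero_mul]
    · simp [hj]
  have he' : e ∉ B := by
    intro h
    obtain ⟨⟨c, hc⟩, -⟩ := (hmem e).mp h
    have h1 := hc i
    have h2 := hc i'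
    rw [(he _).1] at h1 h2
    rw [Pi.single_eq_same] at h1
    rw [Pi.single_eq_of_ne hne] at h2
    exact one_ne_zero (h1.trans h2.symm)
  have hyB' : ∀ b ∈ B, b ∈ J → y * b ∈ B := fun b _ hbJ =>
    hB.sq_le hyJ hyB hy _ (by rw [pow_two]; exact Ideal.mul_mem_mul hyJ hbJ)
  obtain ⟨b, hb, hyb⟩ := htype e y he' heB hyB'
  obtain ⟨⟨c, hc⟩, -⟩ := (hmem _).mp hyb
  obtain ⟨⟨d, hd⟩, -⟩ := (hmem _).mp hb
  have hval : ∀ j, constantCoeff (Φ j (y - b * e)) = -(d * (Pi.single i 1 : ι → k) j) := by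
    intro j
    rw [map_sub, map_sub, (hΦ.mem_iff y).mp hyJ j, map_mul, map_mul, hd, (he j).1, zero_sub]
  have h1 := hc i
  have h2 := hc i'
  rw [hval] at h1 h2
  rw [Pi.single_eq_same, mul_one] at h1
  rw [Pi.single_eq_of_ne hne, mul_zero, neg_zero] at h2
  have hd0 : d = 0 := by
    rw [← h2, neg_eq_zero] at h1
    exact h1
  have hbJ : b ∈ J := (hΦ.mem_iff b).mpr fun j => (hd j).trans hd0
  have := add_mem hyb (heB b hb hbJ)
  rw [mul_comm e b, sub_add_cancel] at this
  exact hyB this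

end IsBranchExpansion

end GenusOne

/-! ### Completions inside products of power series rings -/

section Completion

open PowerSeries

variable {k : Type u} [Field k]

lemma eq_zero_of_forall_X_pow_dvd {f : k⟦X⟧} (h : ∀ n, X ^ n ∣ f) : f = 0 := by
  ext n
  exact X_pow_dvd_iff.mp (h (n + 1)) n (Nat.lt_succ_self n)

/-- A dense homomorphism from `R` to a closed subalgebra `E` of a product of power series rings
that induces the `I`-adic topology on `R` identifies `E` with the `I`-adic completion of `R`. -/
theorem nonempty_adicCompletion_equiv {R : Type u} [CommRing R] [Algebra k R] (I : Ideal R)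
    {κ : Type*} (E : Subalgebra k (κ → k⟦X⟧)) (φ : R →ₐ[k] E)
    (hcont : ∀ n, ∀ r ∈ I ^ n, ∀ i, X ^ n ∣ (φ r : κ → k⟦X⟧) i)
    (hind : ∀ n r, (∀ i, X ^ (2 * n) ∣ (φ r : κ → k⟦X⟧) i) → r ∈ I ^ n)
    (hdense : ∀ n, ∀ e ∈ E, ∃ r, ∀ i, X ^ n ∣ e i - (φ r : κ → k⟦X⟧) i)
    (hclosed : ∀ f : κ → k⟦X⟧, (∀ n, ∃ e ∈ E, ∀ i, X ^ n ∣ f i - e i) → f ∈ E) :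
    Nonempty (AdicCompletion I R ≃ₐ[k] E) := by
  choose σ hσ using fun n (e : E) => hdense (2 * n) e e.2
  have huniq : ∀ n (e : E) r, (∀ i, X ^ (2 * n) ∣ (e : κ → k⟦X⟧) i - (φ r : κ → k⟦X⟧) i) →
      Ideal.Quotient.mk (I ^ n) (σ n e) = Ideal.Quotient.mk (I ^ n) r := by
    intro n e r hr
    rw [Ideal.Quotient.eq]
    apply hind
    intro i
    have := dvd_sub (hr i) (hσ n e i)
    rwa [sub_sub_sub_cancel_left, ← Pi.sub_apply, ← AddSubgroupClass.coe_sub, ← map_sub] at this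
  let g : ∀ n, E →ₐ[k] R ⧸ I ^ n := fun n =>
    { toFun := fun e => Ideal.Quotient.mk (I ^ n) (σ n e)
      map_one' := huniq n 1 1 fun i => by simp
      map_zero' := huniq n 0 0 fun i => by simp
      map_mul' := fun e e' => by
        rw [← map_mul]
        refine huniq n _ _ fun i => ?_
        have h1 := dvd_add ((hσ n e i).mul_right ((e' : κ → k⟦X⟧) i))
          ((hσ n e' i).mul_left ((φ (σ n e) : κ → k⟦X⟧) i))
        simp only [map_mul, MulMemClass.coe_mul, Pi.mul_apply]
        convert h1 using 1
        ring
      map_add' := fun e e' => by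
        rw [← map_add]
        refine huniq n _ _ fun i => ?_
        have h1 := dvd_add (hσ n e i) (hσ n e' i)
        simp only [map_add, AddMemClass.coe_add, Pi.add_apply]
        convert h1 using 1
        ring
      commutes' := fun c => huniq n _ (algebraMap k R c) fun i => by simp }
  have hg : ∀ n (e : E) r, (∀ i, X ^ (2 * n) ∣ (e : κ → k⟦X⟧) i - (φ r : κ → k⟦X⟧) i) →
      g n e = Ideal.Quotient.mk (I ^ n) r := huniq
  have hcomp : ∀ {m n : ℕ} (hle : m ≤ n),
      (Ideal.Quotient.factorₐ k (Ideal.pow_le_pow_right hle)).comp (g n) = g m := by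
    intro m n hle
    ext e
    refine (huniq m e (σ n e) fun i => ?_).symm
    exact (pow_dvd_pow X (Nat.mul_le_mul_left 2 hle)).trans (hσ n e i)
  let G : E →ₐ[k] AdicCompletion I R := AdicCompletion.liftAlgHom I g hcomp
  have hG : ∀ n e, AdicCompletion.evalₐ I n (G e) = g n e :=
    fun n e => AdicCompletion.evalₐ_liftAlgHom I g hcomp n e
  refine ⟨(AlgEquiv.ofBijective G ⟨?_, ?_⟩).symm⟩
  · rw [injective_iff_map_eq_zero]
    intro e he
    apply Subtype.ext
    funext i
    refine eq_zero_of_forall_X_pow_dvd fun n => ?_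
    have h1 : g n e = 0 := by rw [← hG, he, map_zero]
    have h2 : σ n e ∈ I ^ n := Ideal.Quotient.eq_zero_iff_mem.mp h1
    have h3 := (pow_dvd_pow X (by omega : n ≤ 2 * n)).trans (hσ n e i)
    have := dvd_add h3 (hcont n _ h2 i)
    rwa [sub_add_cancel] at this
  · intro x
    obtain ⟨c, rfl⟩ := AdicCompletion.mk_surjective I R x
    have hc : ∀ {m n : ℕ}, m ≤ n → c m - c n ∈ I ^ m := by
      intro m n hmn
      have := c.2 hmn
      rw [SModEq.sub_mem] at this
      simpa using this
    let f : κ → k⟦X⟧ := fun i => PowerSeries.mk fun j => coeff j ((φ (c (j + 1)) : κ → k⟦X⟧) i)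
    have hf : ∀ n i, X ^ n ∣ f i - (φ (c n) : κ → k⟦X⟧) i := by
      intro n i
      rw [X_pow_dvd_iff]
      intro j hj
      have h1 := X_pow_dvd_iff.mp (hcont _ _ (hc (Nat.succ_le_of_lt hj)) i) j (Nat.lt_succ_self j)
      rw [map_sub, AddSubgroupClass.coe_sub, Pi.sub_apply, map_sub] at h1
      rw [map_sub, coeff_mk]
      exact h1
    have hfE : f ∈ E := hclosed f fun n => ⟨φ (c n), (φ (c n)).2, hf n⟩
    refine ⟨⟨f, hfE⟩, AdicCompletion.ext_evalₐ fun n => ?_⟩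
    rw [hG, AdicCompletion.evalₐ_mk, hg n ⟨f, hfE⟩ (c (2 * n)) (hf (2 * n)), eq_comm,
      Ideal.Quotient.eq]
    exact hc (by omega)

end Completion

/-! ### The complete local ring of an elliptic fold point -/

section FoldRing

open PowerSeries

/-- The complete local ring of an elliptic fold point with branches indexed by `Option ι`, as a
subalgebra of its normalization: the tuples of power series that have the same constant
coefficient, and for which the sum of the linear coefficients over `ι` is the remaining linear
coefficient. -/
def foldRing (k : Type u) [Field k] (ι : Type*) [Fintype ι] :
    Subalgebra k (Option ι → k⟦X⟧) where
  carrier := {f | (∃ c, ∀ i, constantCoeff (f i) = c) ∧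
    ∑ i, coeff 1 (f (some i)) = coeff 1 (f none)}
  mul_mem' := by
    rintro f g ⟨⟨c, hc⟩, hf⟩ ⟨⟨d, hd⟩, hg⟩
    refine ⟨⟨c * d, fun i => by simp [hc, hd]⟩, ?_⟩
    have h1 : ∀ i, coeff 1 ((f * g) i) = c * coeff 1 (g i) + d * coeff 1 (f i) := by
      intro i
      rw [Pi.mul_apply, coeff_mul, Finset.Nat.antidiagonal_succ]
      simp [hc, hd, mul_comm]
    simp only [h1, Finset.sum_add_distrib, ← Finset.mul_sum, hf, hg]
  add_mem' := by
    rintro f g ⟨⟨c, hc⟩, hf⟩ ⟨⟨d, hd⟩, hg⟩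
    refine ⟨⟨c + d, fun i => by simp [hc, hd]⟩, ?_⟩
    simp only [Pi.add_apply, map_add, Finset.sum_add_distrib, hf, hg]
  algebraMap_mem' := by
    intro c
    refine ⟨⟨c, fun i => by simp⟩, ?_⟩
    simp

variable {k : Type u} [Field k]

lemma mem_foldRing {ι : Type*} [Fintype ι] {f : Option ι → k⟦X⟧} :
    f ∈ foldRing k ι ↔ (∃ c, ∀ i, constantCoeff (f i) = c) ∧
      ∑ i, coeff 1 (f (some i)) = coeff 1 (f none) := Iff.rfl

lemma coeff_rescaleAlgHom (c : k) (n : ℕ) (f : k⟦X⟧) :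
    coeff n (rescaleAlgHom c f) = c ^ n * coeff n f := by
  have : rescaleAlgHom c f = PowerSeries.rescale c f :=
    congrArg (fun g : k⟦X⟧ →+* k⟦X⟧ => g f) (coe_rescaleAlgHom c)
  rw [this, coeff_rescale]

lemma X_pow_dvd_rescale_iff {c : k} (hc : c ≠ 0) (n : ℕ) (f : k⟦X⟧) :
    X ^ n ∣ rescaleAlgHom c f ↔ X ^ n ∣ f := by
  simp [X_pow_dvd_iff, coeff_rescaleAlgHom, hc]

lemma IsBranchExpansion.rescale {S : Type u} [CommRing S] [Algebra k S] {J : Ideal S} {κ : Type*}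
    {Φ : κ → S →ₐ[k] k⟦X⟧} (hΦ : IsBranchExpansion J Φ) {c : κ → k} (hc : ∀ i, c i ≠ 0) :
    IsBranchExpansion J fun i => (rescaleAlgHom (c i)).comp (Φ i) where
  mem_pow_iff n s := by
    simp only [AlgHom.comp_apply, X_pow_dvd_rescale_iff (hc _)]
    exact hΦ.mem_pow_iff n s
  approx n g := by
    obtain ⟨s, hs⟩ := hΦ.approx n fun i => rescaleAlgHom (c i)⁻¹ (g i)
    refine ⟨s, fun i => ?_⟩
    have h1 : rescaleAlgHom (c i) (Φ i s - rescaleAlgHom (c i)⁻¹ (g i)) =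
        rescaleAlgHom (c i) (Φ i s) - g i := by
      rw [map_sub]
      congr 1
      ext j
      rw [coeff_rescaleAlgHom, coeff_rescaleAlgHom, ← mul_assoc, ← mul_pow,
        mul_inv_cancel₀ (hc i), one_pow, one_mul]
    rw [AlgHom.comp_apply, ← h1, X_pow_dvd_rescale_iff (hc _)]
    exact hs i

/-- A local ring that is cut out in its normalization by the equality of the values on the
branches and by a linear equation with nonzero coefficients on the tangent vectors has `foldRing`
as its completion. The coefficients are absorbed by rescaling the local parameters. -/
theorem nonempty_adicCompletion_equiv_foldRing {R S : Type u} [CommRing R] [CommRing S]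
    [Algebra k R] [Algebra R S] [Algebra k S] [IsScalarTower k R S]
    (hinj : Function.Injective (algebraMap R S)) {I : Ideal R} {J : Ideal S}
    (hIJ : J.comap (algebraMap R S) = I) {ι : Type*} [Fintype ι] {Φ : Option ι → S →ₐ[k] k⟦X⟧}
    (hΦ : IsBranchExpansion J Φ) {a : Option ι → k} (ha : ∀ i, a i ≠ 0)
    (hmem : ∀ s, s ∈ (IsScalarTower.toAlgHom k R S).range ↔
      (∃ c, ∀ i, constantCoeff (Φ i s) = c) ∧ ∑ i, a i * coeff 1 (Φ i s) = 0) :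
    Nonempty (AdicCompletion I R ≃ₐ[k] foldRing k ι) := by
  -- The sign turns `∑ i, a i * t i = 0` into an equation for the branch `none`.
  let c : Option ι → k := fun i => i.elim (-a none) fun j => a (some j)
  have hc : ∀ i, c i ≠ 0 := by
    rintro (_ | i)
    · exact neg_ne_zero.mpr (ha none)
    · exact ha (some i)
  let Ψ : Option ι → S →ₐ[k] k⟦X⟧ := fun i => (rescaleAlgHom (c i)).comp (Φ i)
  have hΨ : IsBranchExpansion J Ψ := hΦ.rescale hc
  have hrange : ∀ s, s ∈ (IsScalarTower.toAlgHom k R S).range ↔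
      (fun i => Ψ i s) ∈ foldRing k ι := by
    intro s
    rw [hmem, mem_foldRing]
    have h0 : ∀ i, constantCoeff (Ψ i s) = constantCoeff (Φ i s) := by
      intro i
      rw [← coeff_zero_eq_constantCoeff_apply, ← coeff_zero_eq_constantCoeff_apply]
      simp [Ψ, coeff_rescaleAlgHom]
    have h1 : ∀ i, coeff 1 (Ψ i s) = c i * coeff 1 (Φ i s) := by
      intro i
      simp [Ψ, coeff_rescaleAlgHom]
    simp only [h0, h1, Fintype.sum_option]
    refine and_congr_right fun _ => ?_
    rw [add_comm, add_eq_zero_iff_eq_neg, ← neg_mul]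
    rfl
  have hsq : ∀ s ∈ J ^ 2, ∃ r ∈ I, algebraMap R S r = s := by
    intro s hs
    obtain ⟨r, hr⟩ : s ∈ (IsScalarTower.toAlgHom k R S).range := by
      rw [hmem]
      rw [hΦ.mem_sq_iff] at hs
      exact ⟨⟨0, fun i => (hs i).1⟩, by simp [(hs _).2]⟩
    refine ⟨r, ?_, hr⟩
    rw [← hIJ, Ideal.mem_comap]
    change algebraMap R S r = s at hr
    rw [hr]
    exact Ideal.pow_le_self two_ne_zero hs
  have hpow : ∀ n, ∀ s ∈ J ^ (2 * (n + 1)), ∃ r ∈ I ^ (n + 1), algebraMap R S r = s := by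
    intro n
    induction n with
    | zero => simpa using hsq
    | succ n ih =>
      intro s hs
      rw [Nat.mul_succ, pow_add] at hs
      refine Submodule.mul_induction_on hs ?_ ?_
      · intro x hx y hy
        obtain ⟨r, hr, rfl⟩ := ih x hx
        obtain ⟨r', hr', rfl⟩ := hsq y hy
        exact ⟨r * r', Ideal.mul_mem_mul hr hr', map_mul _ _ _⟩
      · rintro x y ⟨r, hr, rfl⟩ ⟨r', hr', rfl⟩
        exact ⟨r + r', add_mem hr hr', map_add _ _ _⟩
  let φ : R →ₐ[k] foldRing k ι :=
    AlgHom.codRestrict ((AlgHom.pi Ψ).comp (IsScalarTower.toAlgHom k R S)) (foldRing k ι)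
      fun r => (hrange (algebraMap R S r)).mp ⟨r, rfl⟩
  have hφ : ∀ r i, (φ r : Option ι → k⟦X⟧) i = Ψ i (algebraMap R S r) := fun _ _ => rfl
  refine nonempty_adicCompletion_equiv I (foldRing k ι) φ ?_ ?_ ?_ ?_
  · intro n r hr i
    rw [hφ]
    refine (hΨ.mem_pow_iff n _).mp ?_ i
    refine Ideal.pow_right_mono ?_ n (Ideal.map_pow (algebraMap R S) I n ▸
      Ideal.mem_map_of_mem (algebraMap R S) hr)
    rw [Ideal.map_le_iff_le_comap, hIJ]
  · rintro (_ | n) r hr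
    · simp
    · obtain ⟨r', hr', h⟩ := hpow n (algebraMap R S r) ((hΨ.mem_pow_iff _ _).mpr hr)
      exact hinj h ▸ hr'
  · intro n e he
    obtain ⟨s, hs⟩ := hΨ.approx (n + 2) e
    have hsE : (fun i => Ψ i s) ∈ foldRing k ι := by
      obtain ⟨⟨d, hd⟩, h1⟩ := he
      have hco : ∀ i, ∀ j < 2, coeff j (Ψ i s) = coeff j (e i) := by
        intro i j hj
        have := X_pow_dvd_iff.mp (hs i) j (by omega)
        rwa [map_sub, sub_eq_zero] at this
      refine ⟨⟨d, fun i => ?_⟩, ?_⟩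
      · rw [← hd i, ← coeff_zero_eq_constantCoeff_apply, hco i 0 (by norm_num),
          coeff_zero_eq_constantCoeff_apply]
      · simp only [hco _ 1 (by norm_num), h1]
    obtain ⟨r, rfl⟩ := (hrange s).mpr hsE
    refine ⟨r, fun i => ?_⟩
    rw [hφ, dvd_sub_comm]
    exact (pow_dvd_pow X (by omega)).trans (hs i)
  · intro f hf
    obtain ⟨e, ⟨⟨d, hd⟩, h1⟩, hfe⟩ := hf 2
    have hco : ∀ i, ∀ j < 2, coeff j (f i) = coeff j (e i) := by
      intro i j hj
      have := X_pow_dvd_iff.mp (hfe i) j hj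
      rwa [map_sub, sub_eq_zero] at this
    refine ⟨⟨d, fun i => ?_⟩, ?_⟩
    · rw [← hd i, ← coeff_zero_eq_constantCoeff_apply, hco i 0 (by norm_num),
        coeff_zero_eq_constantCoeff_apply]
    · simp only [hco _ 1 (by norm_num), h1]

end FoldRing

/-! ### Substitution of power series -/

section Substitution

variable {k : Type u} [Field k] {σ τ : Type*}

lemma mem_span_X_image [DecidableEq σ] (s : Finset σ) (f : MvPowerSeries σ k)
    (hf : ∀ d : σ →₀ ℕ, (∀ j ∈ s, d j = 0) → MvPowerSeries.coeff d f = 0) :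
    f ∈ Ideal.span (MvPowerSeries.X '' (s : Set σ) : Set (MvPowerSeries σ k)) := by
  induction s using Finset.induction_on generalizing f with
  | empty =>
    have : f = 0 := by
      ext d
      exact hf d (by simp)
    rw [this]
    exact zero_mem _
  | insert j s _ ih =>
    let f' : MvPowerSeries σ k := fun d => if d j = 0 then MvPowerSeries.coeff d f else 0
    have hf' : ∀ d, MvPowerSeries.coeff d f' = if d j = 0 then MvPowerSeries.coeff d f else 0 :=
      fun d => rfl
    have h1 : f' ∈ Ideal.span (MvPowerSeries.X '' (s : Set σ) : Set (MvPowerSeries σ k)) := by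
      refine ih f' fun d hd => ?_
      rw [hf']
      split_ifs with h
      · refine hf d fun i hi => ?_
        rcases Finset.mem_insert.mp hi with rfl | hi
        · exact h
        · exact hd i hi
      · rfl
    have h2 : MvPowerSeries.X j ∣ f - f' := by
      rw [MvPowerSeries.X_dvd_iff]
      intro d hd
      rw [map_sub, hf', if_pos hd, sub_self]
    have h3 : f = (f - f') + f' := by ring
    rw [h3]
    refine add_mem ?_ (Ideal.span_mono (Set.image_mono (by simp)) h1)
    obtain ⟨g, hg⟩ := h2
    rw [hg]
    exact Ideal.mul_mem_right _ _ (Ideal.subset_span ⟨j, by simp, rfl⟩)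

lemma exists_eq_C_add_sum_X_mul [Fintype σ] (f : MvPowerSeries σ k) :
    ∃ g : σ → MvPowerSeries σ k,
      f = MvPowerSeries.C (MvPowerSeries.constantCoeff f) + ∑ j, MvPowerSeries.X j * g j := by
  classical
  have h := mem_span_X_image Finset.univ (f - MvPowerSeries.C (MvPowerSeries.constantCoeff f))
    (fun d hd => by
      have : d = 0 := Finsupp.ext fun j => hd j (Finset.mem_univ j)
      rw [this]
      simp)
  rw [Finset.coe_univ, Set.image_univ] at h
  obtain ⟨g, hg⟩ := Ideal.mem_span_range_iff_exists_fun.mp h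
  refine ⟨g, ?_⟩
  simp only [mul_comm (MvPowerSeries.X _)]
  rw [hg]
  ring

lemma mem_maximalIdeal_iff_constantCoeff {f : MvPowerSeries σ k} :
    f ∈ maximalIdeal (MvPowerSeries σ k) ↔ MvPowerSeries.constantCoeff f = 0 := by
  rw [mem_maximalIdeal, mem_nonunits_iff, MvPowerSeries.isUnit_iff_constantCoeff,
    isUnit_iff_ne_zero, not_not]

/-- Ideals of a Noetherian local ring are closed. -/
lemma mem_of_forall_mem_sup_pow {A : Type*} [CommRing A] [IsLocalRing A] [IsNoetherianRing A]
    {I : Ideal A} {f : A} (h : ∀ n, f ∈ I ⊔ maximalIdeal A ^ n) : f ∈ I := by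
  by_cases hI : I = ⊤
  · exact hI ▸ Submodule.mem_top
  have : Nontrivial (A ⧸ I) := Ideal.Quotient.nontrivial_iff.mpr hI
  have : IsLocalRing (A ⧸ I) :=
    IsLocalRing.of_surjective' (Ideal.Quotient.mk I) Ideal.Quotient.mk_surjective
  rw [← Ideal.Quotient.eq_zero_iff_mem]
  have hN : (maximalIdeal A).map (Ideal.Quotient.mk I) ≠ ⊤ := by
    intro h
    have h1 := Ideal.comap_map_of_surjective _ (Ideal.Quotient.mk_surjective (I := I))
      (maximalIdeal A)
    rw [h, Ideal.comap_top, ← RingHom.ker_eq_comap_bot, Ideal.mk_ker,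
      sup_eq_left.mpr (le_maximalIdeal hI)] at h1
    exact (Ideal.IsPrime.ne_top inferInstance) h1.symm
  have := Ideal.iInf_pow_eq_bot_of_isLocalRing _ hN
  rw [← Ideal.mem_bot, ← this, Submodule.mem_iInf]
  intro n
  rw [← Ideal.map_pow]
  obtain ⟨a, ha, b, hb, rfl⟩ := Submodule.mem_sup.mp (h n)
  rw [map_add, Ideal.Quotient.eq_zero_iff_mem.mpr ha, zero_add]
  exact Ideal.mem_map_of_mem _ hb

/-- Two homomorphisms of power series rings that are congruent on the variables modulo an ideal are
congruent: by induction, they are congruent modulo `I + 𝔪 ^ n` for all `n`. -/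
lemma algHom_sub_mem [Fintype τ] [Finite σ] (I : Ideal (MvPowerSeries σ k))
    (θ₁ θ₂ : MvPowerSeries τ k →ₐ[k] MvPowerSeries σ k)
    (h₁ : ∀ j, MvPowerSeries.constantCoeff (θ₁ (MvPowerSeries.X j)) = 0)
    (h : ∀ j, θ₁ (MvPowerSeries.X j) - θ₂ (MvPowerSeries.X j) ∈ I) (f : MvPowerSeries τ k) :
    θ₁ f - θ₂ f ∈ I := by
  refine mem_of_forall_mem_sup_pow fun n => ?_
  induction n generalizing f with
  | zero => simp
  | succ n ih =>
    obtain ⟨g, hg⟩ := exists_eq_C_add_sum_X_mul f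
    have hC : ∀ c : k, θ₁ (MvPowerSeries.C c) = θ₂ (MvPowerSeries.C c) := fun c => by
      have := (θ₁.commutes c).trans (θ₂.commutes c).symm
      exact this
    have key : θ₁ f - θ₂ f = ∑ j, (θ₁ (MvPowerSeries.X j) * (θ₁ (g j) - θ₂ (g j)) +
        (θ₁ (MvPowerSeries.X j) - θ₂ (MvPowerSeries.X j)) * θ₂ (g j)) := by
      conv_lhs => rw [hg]
      simp only [map_add, map_sum, map_mul, hC]
      rw [add_sub_add_left_eq_sub, ← Finset.sum_sub_distrib]
      exact Finset.sum_congr rfl fun j _ => by ring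
    rw [key]
    refine sum_mem fun j _ => add_mem ?_ (Ideal.mem_sup_left (Ideal.mul_mem_right _ _ (h j)))
    have h2 : θ₁ (MvPowerSeries.X j) * (θ₁ (g j) - θ₂ (g j)) ∈
        maximalIdeal _ * (I ⊔ maximalIdeal (MvPowerSeries σ k) ^ n) :=
      Ideal.mul_mem_mul (mem_maximalIdeal_iff_constantCoeff.mpr (h₁ j)) (ih (g j))
    rw [Ideal.mul_sup, ← pow_succ'] at h2
    exact (sup_le_sup_right Ideal.mul_le_right _ :
      _ ≤ I ⊔ maximalIdeal (MvPowerSeries σ k) ^ (n + 1)) h2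

/-- The restriction `f ↦ f (v (t))` of power series in several variables to the branch
parametrized by `v`. -/
noncomputable def evalBranch [Finite σ] (v : σ → PowerSeries k)
    (hv : ∀ j, PowerSeries.constantCoeff (v j) = 0) : MvPowerSeries σ k →ₐ[k] PowerSeries k :=
  MvPowerSeries.substAlgHom (MvPowerSeries.hasSubst_of_constantCoeff_zero hv)

section

variable [Fintype σ] {v : σ → PowerSeries k} (hv : ∀ j, PowerSeries.constantCoeff (v j) = 0)

@[simp]
lemma evalBranch_X (j : σ) : evalBranch v hv (MvPowerSeries.X j) = v j :=
  MvPowerSeries.substAlgHom_X _ j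

@[simp]
lemma evalBranch_C (c : k) : evalBranch v hv (MvPowerSeries.C c) = PowerSeries.C c :=
  (evalBranch v hv).commutes c

lemma constantCoeff_evalBranch (f : MvPowerSeries σ k) :
    PowerSeries.constantCoeff (evalBranch v hv f) = MvPowerSeries.constantCoeff f := by
  obtain ⟨g, hg⟩ := exists_eq_C_add_sum_X_mul f
  conv_lhs => rw [hg]
  simp [hv]

/-- The linear coefficient of the restriction to a branch depends linearly on the tangent
vector. -/
lemma exists_coeff_one_evalBranch (f : MvPowerSeries σ k) :
    ∃ a : σ → k, ∀ (v : σ → PowerSeries k) (hv : ∀ j, PowerSeries.constantCoeff (v j) = 0),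
      PowerSeries.coeff 1 (evalBranch v hv f) = ∑ j, a j * PowerSeries.coeff 1 (v j) := by
  obtain ⟨g, hg⟩ := exists_eq_C_add_sum_X_mul f
  refine ⟨fun j => MvPowerSeries.constantCoeff (g j), fun v hv => ?_⟩
  conv_lhs => rw [hg]
  simp only [map_add, map_sum, map_mul, evalBranch_C, evalBranch_X, PowerSeries.coeff_C]
  rw [if_neg one_ne_zero, zero_add]
  refine Finset.sum_congr rfl fun j _ => ?_
  rw [PowerSeries.coeff_mul, Finset.Nat.antidiagonal_succ]
  simp [hv, constantCoeff_evalBranch, mul_comm]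

/-- If the branch satisfies `x_j = v_j (x_h)` modulo `I`, then every power series is congruent to
its restriction to the branch, with the parameter replaced by `x_h`. -/
lemma sub_toMvPowerSeries_evalBranch_mem (I : Ideal (MvPowerSeries σ k)) (h : σ)
    (hI : ∀ j, MvPowerSeries.X j - (v j).toMvPowerSeries h ∈ I) (f : MvPowerSeries σ k) :
    f - (evalBranch v hv f).toMvPowerSeries h ∈ I :=
  algHom_sub_mem I (AlgHom.id k _)
    ((PowerSeries.toMvPowerSeries h).comp (evalBranch v hv)) (fun j => by simp)
    (fun j => by simpa using hI j) f

/-- The previous congruence for the colon ideal of `I` and `q`. -/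
lemma mul_sub_toMvPowerSeries_evalBranch_mem (I : Ideal (MvPowerSeries σ k)) (h : σ)
    (q : MvPowerSeries σ k) (hI : ∀ j, q * (MvPowerSeries.X j - (v j).toMvPowerSeries h) ∈ I)
    (f : MvPowerSeries σ k) : q * f - q * (evalBranch v hv f).toMvPowerSeries h ∈ I := by
  have := sub_toMvPowerSeries_evalBranch_mem hv (Submodule.colon I {q}) h (fun j => by
    rw [Submodule.mem_colon_singleton, smul_eq_mul, mul_comm]
    exact hI j) f
  rwa [Submodule.mem_colon_singleton, smul_eq_mul, mul_comm, mul_sub] at this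

lemma evalBranch_toMvPowerSeries_eq {h : σ} (θ : PowerSeries k →ₐ[k] PowerSeries k)
    (hθ : θ PowerSeries.X = v h) (p : PowerSeries k) :
    evalBranch v hv (p.toMvPowerSeries h) = θ p := by
  have := algHom_sub_mem (⊥ : Ideal (MvPowerSeries Unit k))
    ((evalBranch v hv).comp (PowerSeries.toMvPowerSeries h)) θ (fun j => by
      change PowerSeries.constantCoeff
        (evalBranch v hv ((PowerSeries.X : PowerSeries k).toMvPowerSeries h)) = 0
      rw [PowerSeries.toMvPowerSeries_X, evalBranch_X, hv]) (fun j => by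
      change evalBranch v hv ((PowerSeries.X : PowerSeries k).toMvPowerSeries h) -
        θ PowerSeries.X ∈ _
      rw [PowerSeries.toMvPowerSeries_X, evalBranch_X, hθ, sub_self]
      exact zero_mem _) p
  exact sub_eq_zero.mp this

lemma evalBranch_toMvPowerSeries {h : σ} (hX : v h = PowerSeries.X) (p : PowerSeries k) :
    evalBranch v hv (p.toMvPowerSeries h) = p :=
  evalBranch_toMvPowerSeries_eq hv (AlgHom.id k _) hX.symm p

end

end Substitution

/-! ### Presentations by equations -/

section Models

variable {k : Type u} [Field k]

/-- A presentation of `foldRing`: branches `v i` give a surjection from a power series ring whose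
kernel is `I`. -/
lemma nonempty_foldRing_equiv_quotient {σ ι : Type*} [Fintype σ] [Fintype ι]
    (I : Ideal (MvPowerSeries σ k)) (v : Option ι → σ → PowerSeries k)
    (hv : ∀ i j, PowerSeries.constantCoeff (v i j) = 0)
    (htan : ∀ j, ∑ i, PowerSeries.coeff 1 (v (some i) j) = PowerSeries.coeff 1 (v none j))
    (hI : ∀ f, f ∈ I ↔ ∀ i, evalBranch (v i) (hv i) f = 0)
    (hsurj : ∀ e ∈ foldRing k ι, ∃ f, ∀ i, evalBranch (v i) (hv i) f = e i) :
    Nonempty (foldRing k ι ≃ₐ[k] MvPowerSeries σ k ⧸ I) := by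
  have hmem : ∀ f, AlgHom.pi (fun i => evalBranch (v i) (hv i)) f ∈ foldRing k ι := by
    intro f
    obtain ⟨a, ha⟩ := exists_coeff_one_evalBranch f
    refine ⟨⟨MvPowerSeries.constantCoeff f, fun i => constantCoeff_evalBranch (hv i) f⟩, ?_⟩
    change ∑ i, PowerSeries.coeff 1 (evalBranch (v (some i)) (hv (some i)) f) =
      PowerSeries.coeff 1 (evalBranch (v none) (hv none) f)
    simp only [ha]
    rw [Finset.sum_comm]
    simp only [← Finset.mul_sum, htan]
  let φ : MvPowerSeries σ k →ₐ[k] foldRing k ι :=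
    AlgHom.codRestrict (AlgHom.pi fun i => evalBranch (v i) (hv i)) _ hmem
  have hφ : Function.Surjective φ := by
    rintro ⟨e, he⟩
    obtain ⟨f, hf⟩ := hsurj e he
    exact ⟨f, Subtype.ext (funext hf)⟩
  have hker : RingHom.ker φ = I := by
    ext f
    rw [hI, RingHom.mem_ker, ← Subtype.coe_inj]
    exact funext_iff
  exact ⟨((Ideal.quotientEquivAlgOfEq k hker).symm.trans
    (Ideal.quotientKerAlgEquivOfSurjective hφ)).symm⟩

lemma exists_eq_C_add_X_mul (f : PowerSeries k) :
    ∃ g, f = PowerSeries.C (PowerSeries.constantCoeff f) + PowerSeries.X * g := by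
  obtain ⟨g, hg⟩ : PowerSeries.X ∣ f - PowerSeries.C (PowerSeries.constantCoeff f) := by
    rw [PowerSeries.X_dvd_iff]
    simp
  exact ⟨g, by rw [← hg]; ring⟩

/-! ### Coordinate axes and the diagonal -/

section Lines

variable {n : ℕ}

/-- The branches `some l`, the coordinate axes of affine `n`-space, and the branch `none`, the
diagonal. The tangent vector of the diagonal is the sum of those of the axes. -/
noncomputable def axes (k : Type u) [Field k] (n : ℕ) : Option (Fin n) → Fin n → PowerSeries k
  | some l => Pi.single l PowerSeries.X
  | none => fun _ => PowerSeries.X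

lemma constantCoeff_axes (i : Option (Fin n)) (j : Fin n) :
    PowerSeries.constantCoeff (axes k n i j) = 0 := by
  rcases i with _ | l
  · simp [axes]
  · by_cases h : j = l
    · simp [axes, h]
    · simp [axes, h]

/-- The power series `c + ∑ h, x_h p_h (x_h) + x_{i₀} x_{i₁} r (x_{i₀})`, with only one mixed
monomial in each degree. -/
noncomputable def linesNormalForm (i₀ i₁ : Fin n) (c : k) (p : Fin n → PowerSeries k)
    (r : PowerSeries k) : MvPowerSeries (Fin n) k :=
  MvPowerSeries.C c + ∑ h, MvPowerSeries.X h * (p h).toMvPowerSeries h +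
    MvPowerSeries.X i₀ * MvPowerSeries.X i₁ * r.toMvPowerSeries i₀

lemma evalBranch_linesNormalForm_some {i₀ i₁ : Fin n} (hne : i₀ ≠ i₁) (c : k)
    (p : Fin n → PowerSeries k) (r : PowerSeries k) (l : Fin n) :
    evalBranch (axes k n (some l)) (constantCoeff_axes _) (linesNormalForm i₀ i₁ c p r) =
      PowerSeries.C c + PowerSeries.X * p l := by
  have h1 : axes k n (some l) i₀ * axes k n (some l) i₁ = 0 := by
    by_cases h : i₀ = l
    · have : i₁ ≠ l := fun h' => hne (h.trans h'.symm)
      simp [axes, this]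
    · simp [axes, h]
  simp only [linesNormalForm, map_add, map_sum, map_mul, evalBranch_C, evalBranch_X, h1, zero_mul,
    add_zero]
  congr 1
  rw [Finset.sum_eq_single l]
  · rw [evalBranch_toMvPowerSeries _ (by simp [axes])]
    simp [axes]
  · intro h _ hh
    simp [axes, hh]
  · simp

lemma evalBranch_linesNormalForm_none (i₀ i₁ : Fin n) (c : k)
    (p : Fin n → PowerSeries k) (r : PowerSeries k) :
    evalBranch (axes k n none) (constantCoeff_axes _) (linesNormalForm i₀ i₁ c p r) =
      PowerSeries.C c + PowerSeries.X * ∑ h, p h + PowerSeries.X ^ 2 * r := by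
  have h0 : ∀ j, axes k n none j = PowerSeries.X := fun _ => rfl
  simp only [linesNormalForm, map_add, map_sum, map_mul, evalBranch_C, evalBranch_X, h0,
    evalBranch_toMvPowerSeries _ (h0 _)]
  rw [Finset.mul_sum, pow_two]

/-- Modulo the relations `x_h x_i = x_{i₀} x_{i₁}` and `x_{i₀} x_{i₁} x_j = x_{i₀} ^ 2 x_{i₁}`
every power series is congruent to one in normal form. -/
lemma exists_linesNormalForm {I : Ideal (MvPowerSeries (Fin n) k)} {i₀ i₁ : Fin n}
    (hquad : ∀ h i, h ≠ i → (MvPowerSeries.X h * MvPowerSeries.X i -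
      MvPowerSeries.X i₀ * MvPowerSeries.X i₁ : MvPowerSeries (Fin n) k) ∈ I)
    (hcub : ∀ j, (MvPowerSeries.X i₀ * MvPowerSeries.X i₁ *
      (MvPowerSeries.X j - MvPowerSeries.X i₀) : MvPowerSeries (Fin n) k) ∈ I)
    (f : MvPowerSeries (Fin n) k) : ∃ c p r, f - linesNormalForm i₀ i₁ c p r ∈ I := by
  have hmixed : ∀ h i v, h ≠ i → ∃ r : PowerSeries k, MvPowerSeries.X h * MvPowerSeries.X i * v -
      MvPowerSeries.X i₀ * MvPowerSeries.X i₁ * r.toMvPowerSeries i₀ ∈ I := by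
    intro h i v hhi
    refine ⟨evalBranch (axes k n none) (constantCoeff_axes _) v, ?_⟩
    have h1 := mul_sub_toMvPowerSeries_evalBranch_mem (constantCoeff_axes (k := k) none) I i₀
      (MvPowerSeries.X i₀ * MvPowerSeries.X i₁) (fun j => by
        change _ * (MvPowerSeries.X j - PowerSeries.toMvPowerSeries i₀ PowerSeries.X) ∈ I
        rw [PowerSeries.toMvPowerSeries_X]
        exact hcub j) v
    have h2 := I.mul_mem_right v (hquad h i hhi)
    rw [sub_mul] at h2
    have := add_mem h2 h1
    rwa [sub_add_sub_cancel] at this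
  -- `x_h g` is congruent to a power series in `x_h` plus a mixed term
  have hvar : ∀ h g, ∃ p r : PowerSeries k, MvPowerSeries.X h * g -
      (MvPowerSeries.X h * p.toMvPowerSeries h +
        MvPowerSeries.X i₀ * MvPowerSeries.X i₁ * r.toMvPowerSeries i₀) ∈ I := by
    intro h g
    have h1 := sub_toMvPowerSeries_evalBranch_mem (constantCoeff_axes (k := k) (some h))
      (Ideal.span (MvPowerSeries.X '' {j | j ≠ h})) h (fun j => by
        by_cases hj : j = h
        · have : axes k n (some h) j = PowerSeries.X := by simp [axes, hj]
          rw [this, PowerSeries.toMvPowerSeries_X, hj, sub_self]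
          exact zero_mem _
        · have : axes k n (some h) j = 0 := by simp [axes, hj]
          rw [this, map_zero, sub_zero]
          exact Ideal.subset_span ⟨j, hj, rfl⟩) g
    refine ⟨evalBranch (axes k n (some h)) (constantCoeff_axes _) g, ?_⟩
    suffices H : ∀ w ∈ Ideal.span (MvPowerSeries.X '' {j | j ≠ h}), ∀ v, ∃ r : PowerSeries k,
        MvPowerSeries.X h * (w * v) -
          MvPowerSeries.X i₀ * MvPowerSeries.X i₁ * r.toMvPowerSeries i₀ ∈ I by
      obtain ⟨r, hr⟩ := H _ h1 1
      refine ⟨r, ?_⟩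
      rwa [mul_one, mul_sub, sub_sub] at hr
    intro w hw
    refine Submodule.span_induction (p := fun w _ => ∀ v, ∃ r : PowerSeries k,
        MvPowerSeries.X h * (w * v) -
          MvPowerSeries.X i₀ * MvPowerSeries.X i₁ * r.toMvPowerSeries i₀ ∈ I) ?_ ?_ ?_ ?_ hw
    · rintro _ ⟨j, hj, rfl⟩ v
      obtain ⟨r, hr⟩ := hmixed h j v (Ne.symm hj)
      exact ⟨r, by rwa [← mul_assoc]⟩
    · exact fun v => ⟨0, by simp⟩
    · intro x y _ _ hx hy v
      obtain ⟨r, hr⟩ := hx v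
      obtain ⟨r', hr'⟩ := hy v
      refine ⟨r + r', ?_⟩
      have := add_mem hr hr'
      rw [map_add]
      convert this using 1
      ring
    · intro a x _ hx v
      obtain ⟨r, hr⟩ := hx (a * v)
      refine ⟨r, ?_⟩
      rwa [smul_eq_mul, mul_assoc, mul_left_comm a x v]
  obtain ⟨g, hg⟩ := exists_eq_C_add_sum_X_mul f
  choose p r hpr using fun h => hvar h (g h)
  refine ⟨MvPowerSeries.constantCoeff f, p, ∑ h, r h, ?_⟩
  have h1 := sum_mem (t := Finset.univ) fun h (_ : h ∈ Finset.univ) => hpr h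
  convert h1 using 1
  conv_lhs => enter [1]; rw [hg]
  rw [linesNormalForm, map_sum, Finset.sum_sub_distrib, Finset.sum_add_distrib, ← Finset.mul_sum]
  ring

/-- The relations suffice to cut out the union of the axes and the diagonal, because the
restrictions to the branches determine a power series in normal form. -/
theorem nonempty_foldRing_equiv_of_relations {I : Ideal (MvPowerSeries (Fin n) k)} {i₀ i₁ : Fin n}
    (hne : i₀ ≠ i₁)
    (hquad : ∀ h i, h ≠ i → (MvPowerSeries.X h * MvPowerSeries.X i -
      MvPowerSeries.X i₀ * MvPowerSeries.X i₁ : MvPowerSeries (Fin n) k) ∈ I)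
    (hcub : ∀ j, (MvPowerSeries.X i₀ * MvPowerSeries.X i₁ *
      (MvPowerSeries.X j - MvPowerSeries.X i₀) : MvPowerSeries (Fin n) k) ∈ I)
    (hI : ∀ i, I ≤ RingHom.ker (evalBranch (axes k n i) (constantCoeff_axes i))) :
    Nonempty (foldRing k (Fin n) ≃ₐ[k] MvPowerSeries (Fin n) k ⧸ I) := by
  refine nonempty_foldRing_equiv_quotient I (axes k n) constantCoeff_axes ?_ ?_ ?_
  · intro j
    rw [Finset.sum_eq_single j]
    · simp [axes]
    · intro l _ hl
      simp [axes, hl.symm]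
    · simp
  · intro f
    refine ⟨fun hf i => hI i hf, fun hf => ?_⟩
    obtain ⟨c, p, r, hfI⟩ := exists_linesNormalForm hquad hcub f
    have h0 : ∀ i, evalBranch (axes k n i) (constantCoeff_axes i)
        (linesNormalForm i₀ i₁ c p r) = 0 := by
      intro i
      have h1 := RingHom.mem_ker.mp (hI i hfI)
      rwa [map_sub, hf i, zero_sub, neg_eq_zero] at h1
    have hc : c = 0 := by
      have h1 := congrArg PowerSeries.constantCoeff (h0 none)
      rw [evalBranch_linesNormalForm_none] at h1
      simpa using h1
    have hp : ∀ l, p l = 0 := by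
      intro l
      have h1 := h0 (some l)
      rw [evalBranch_linesNormalForm_some hne, hc, map_zero, zero_add] at h1
      exact (mul_eq_zero.mp h1).resolve_left PowerSeries.X_ne_zero
    have hr : r = 0 := by
      have h1 := h0 none
      rw [evalBranch_linesNormalForm_none, hc, map_zero, zero_add,
        Finset.sum_eq_zero fun l _ => hp l, mul_zero, zero_add] at h1
      exact (mul_eq_zero.mp h1).resolve_left (pow_ne_zero 2 PowerSeries.X_ne_zero)
    have hnf : linesNormalForm i₀ i₁ c p r = 0 := by
      simp [linesNormalForm, hc, hp, hr]
    rwa [hnf, sub_zero] at hfI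
  · rintro e ⟨⟨c, hc⟩, h1⟩
    choose p hp using fun i => exists_eq_C_add_X_mul (e i)
    have hcoeff : ∀ i, PowerSeries.constantCoeff (p i) = PowerSeries.coeff 1 (e i) := by
      intro i
      conv_rhs => rw [hp i]
      rw [map_add, PowerSeries.coeff_C, if_neg one_ne_zero, zero_add,
        PowerSeries.coeff_succ_X_mul 0, PowerSeries.coeff_zero_eq_constantCoeff_apply]
    obtain ⟨r, hr⟩ : PowerSeries.X ∣ p none - ∑ l, p (some l) := by
      rw [PowerSeries.X_dvd_iff, map_sub, map_sum]
      simp only [hcoeff, h1, sub_self]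
    refine ⟨linesNormalForm i₀ i₁ c (fun l => p (some l)) r, ?_⟩
    rintro (_ | l)
    · rw [evalBranch_linesNormalForm_none, hp none, hc]
      linear_combination (-PowerSeries.X) * hr
    · rw [evalBranch_linesNormalForm_some hne, hp (some l), hc]

theorem nonempty_foldRing_equiv_triplePoint :
    Nonempty (foldRing k (Fin 2) ≃ₐ[k] MvPowerSeries (Fin 2) k ⧸ triplePointIdeal k) := by
  refine nonempty_foldRing_equiv_of_relations (i₀ := 0) (i₁ := 1) (by norm_num) ?_ ?_ ?_
  · intro h i hhi
    have : (MvPowerSeries.X h * MvPowerSeries.X i : MvPowerSeries (Fin 2) k) =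
        MvPowerSeries.X 0 * MvPowerSeries.X 1 := by
      fin_cases h <;> fin_cases i
      · exact absurd rfl hhi
      · rfl
      · exact mul_comm _ _
      · exact absurd rfl hhi
    rw [this, sub_self]
    exact zero_mem _
  · intro j
    fin_cases j
    · simp
    · exact Ideal.subset_span rfl
  · intro i
    rw [triplePointIdeal, Ideal.span_le, Set.singleton_subset_iff]
    change evalBranch _ _ _ = 0
    simp only [map_mul, map_sub, evalBranch_X]
    rcases i with _ | i
    · simp [axes]
    · fin_cases i <;> simp [axes]

theorem nonempty_foldRing_equiv_generalLines (m : ℕ) :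
    Nonempty (foldRing k (Fin (m + 3)) ≃ₐ[k]
      MvPowerSeries (Fin (m + 3)) k ⧸ generalLinesIdeal k (m + 3)) := by
  have hrel : ∀ a b c : Fin (m + 3), a ≠ b → a ≠ c → (MvPowerSeries.X a * MvPowerSeries.X b -
      MvPowerSeries.X a * MvPowerSeries.X c : MvPowerSeries _ k) ∈ generalLinesIdeal k (m + 3) := by
    intro a b c hab hac
    by_cases hbc : b = c
    · rw [hbc, sub_self]
      exact zero_mem _
    · exact Ideal.subset_span ⟨a, b, c, hab, hac, hbc, by ring⟩
  have h01 : (0 : Fin (m + 3)) ≠ 1 := Fin.ne_of_val_ne (by simp)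
  have h02 : (0 : Fin (m + 3)) ≠ 2 := Fin.ne_of_val_ne (by
    simp [Nat.mod_eq_of_lt (show 2 < m + 3 by omega)])
  have h12 : (1 : Fin (m + 3)) ≠ 2 := Fin.ne_of_val_ne (by
    simp [Nat.mod_eq_of_lt (show 2 < m + 3 by omega)])
  refine nonempty_foldRing_equiv_of_relations (i₀ := 0) (i₁ := 1) h01 ?_ ?_ ?_
  · intro h i hhi
    by_cases h0 : h = 0
    · rw [h0] at hhi ⊢
      exact hrel 0 i 1 hhi h01
    · have := add_mem (hrel h i 0 hhi h0) (hrel 0 h 1 (Ne.symm h0) h01)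
      convert this using 1
      ring
  · intro j
    by_cases h0 : j = 0
    · rw [h0, sub_self, mul_zero]
      exact zero_mem _
    by_cases h1 : j = 1
    · rw [h1]
      have h3 := Ideal.mul_mem_left _ (MvPowerSeries.X 1) (hrel 0 1 2 h01 h02)
      have h4 := Ideal.mul_mem_left _ (MvPowerSeries.X 0) (hrel 1 0 2 h01.symm h12)
      have := sub_mem h3 h4
      convert this using 1
      ring
    · have := Ideal.mul_mem_left _ (MvPowerSeries.X 0) (hrel 1 j 0 (Ne.symm h1) h01.symm)
      convert this using 1
      ring
  · intro i
    rw [generalLinesIdeal, Ideal.span_le]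
    rintro _ ⟨a, b, c, hab, hac, hbc, rfl⟩
    change evalBranch _ _ _ = 0
    simp only [map_mul, map_sub, evalBranch_X]
    rcases i with _ | l
    · simp [axes]
    · by_cases hal : a = l
      · have hb : b ≠ l := fun h => hab (hal.trans h.symm)
        have hc : c ≠ l := fun h => hac (hal.trans h.symm)
        simp [axes, hb, hc]
      · simp [axes, hal]

end Lines

end Models

/-! ### The tacnode -/

section PlaneModels

variable {k : Type u} [Field k]

section Tacnode

/-- The two branches `y = 0` and `y = x ^ 2` of the tacnode, parametrized by `x`. -/
noncomputable def tacnodeBranches (k : Type u) [Field k] :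
    Option (Fin 1) → Fin 2 → PowerSeries k
  | some _ => ![PowerSeries.X, 0]
  | none => ![PowerSeries.X, PowerSeries.X ^ 2]

lemma constantCoeff_tacnodeBranches (i : Option (Fin 1)) (j : Fin 2) :
    PowerSeries.constantCoeff (tacnodeBranches k i j) = 0 := by
  rcases i with _ | l <;> fin_cases j <;> simp [tacnodeBranches]

lemma evalBranch_tacnode_normalForm_some (a b : PowerSeries k) (l : Fin 1) :
    evalBranch (tacnodeBranches k (some l)) (constantCoeff_tacnodeBranches _)
      (a.toMvPowerSeries 0 + MvPowerSeries.X 1 * b.toMvPowerSeries 0) = a := by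
  rw [map_add, map_mul, evalBranch_toMvPowerSeries _ (h := 0) (by rfl), evalBranch_X]
  simp [tacnodeBranches]

lemma evalBranch_tacnode_normalForm_none (a b : PowerSeries k) :
    evalBranch (tacnodeBranches k none) (constantCoeff_tacnodeBranches _)
      (a.toMvPowerSeries 0 + MvPowerSeries.X 1 * b.toMvPowerSeries 0) =
      a + PowerSeries.X ^ 2 * b := by
  have h : ∀ p : PowerSeries k, evalBranch (tacnodeBranches k none)
      (constantCoeff_tacnodeBranches _) (p.toMvPowerSeries 0) = p :=
    evalBranch_toMvPowerSeries _ rfl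
  rw [map_add, map_mul, h, h, evalBranch_X]
  simp [tacnodeBranches]

lemma exists_tacnode_normalForm (f : MvPowerSeries (Fin 2) k) : ∃ a b : PowerSeries k,
    f - (a.toMvPowerSeries 0 + MvPowerSeries.X 1 * b.toMvPowerSeries 0) ∈ tacnodeIdeal k := by
  -- Modulo `y` only the restriction to `y = 0` matters; on multiples of `y`, only the one to
  -- `y = x ^ 2`.
  have h1 := sub_toMvPowerSeries_evalBranch_mem (constantCoeff_tacnodeBranches (k := k) (some 0))
    (Ideal.span {MvPowerSeries.X 1}) 0 (fun j => by
      fin_cases j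
      · simp [tacnodeBranches]
      · simp [tacnodeBranches]) f
  obtain ⟨g, hg⟩ := Ideal.mem_span_singleton.mp h1
  have h2 := mul_sub_toMvPowerSeries_evalBranch_mem (constantCoeff_tacnodeBranches (k := k) none)
    (tacnodeIdeal k) 0 (MvPowerSeries.X 1) (fun j => by
      fin_cases j
      · simp [tacnodeBranches]
      · change MvPowerSeries.X 1 * (MvPowerSeries.X 1 -
          PowerSeries.toMvPowerSeries 0 (PowerSeries.X ^ 2)) ∈ tacnodeIdeal k
        rw [map_pow, PowerSeries.toMvPowerSeries_X]
        exact Ideal.subset_span rfl) g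
  refine ⟨evalBranch (tacnodeBranches k (some 0)) (constantCoeff_tacnodeBranches _) f,
    evalBranch (tacnodeBranches k none) (constantCoeff_tacnodeBranches _) g, ?_⟩
  rwa [← sub_sub, hg]

theorem nonempty_foldRing_equiv_tacnode :
    Nonempty (foldRing k (Fin 1) ≃ₐ[k] MvPowerSeries (Fin 2) k ⧸ tacnodeIdeal k) := by
  have hle : ∀ i, tacnodeIdeal k ≤
      RingHom.ker (evalBranch (tacnodeBranches k i) (constantCoeff_tacnodeBranches i)) := by
    intro i
    rw [tacnodeIdeal, Ideal.span_le, Set.singleton_subset_iff]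
    change evalBranch _ _ _ = 0
    simp only [map_mul, map_sub, map_pow, evalBranch_X]
    rcases i with _ | i <;> simp [tacnodeBranches]
  refine nonempty_foldRing_equiv_quotient _ (tacnodeBranches k) constantCoeff_tacnodeBranches
    ?_ ?_ ?_
  · intro j
    fin_cases j
    · simp [tacnodeBranches]
    · simp [tacnodeBranches, PowerSeries.coeff_X_pow]
  · intro f
    refine ⟨fun hf i => hle i hf, fun hf => ?_⟩
    obtain ⟨a, b, hab⟩ := exists_tacnode_normalForm f
    have ha : a = 0 := by
      have h1 := RingHom.mem_ker.mp (hle (some 0) hab)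
      rw [map_sub, hf, evalBranch_tacnode_normalForm_some, zero_sub, neg_eq_zero] at h1
      exact h1
    have hb : b = 0 := by
      have h1 := RingHom.mem_ker.mp (hle none hab)
      rw [map_sub, hf, evalBranch_tacnode_normalForm_none, zero_sub, neg_eq_zero, ha,
        zero_add] at h1
      exact (mul_eq_zero.mp h1).resolve_left (pow_ne_zero 2 PowerSeries.X_ne_zero)
    simpa [ha, hb] using hab
  · rintro e ⟨⟨c, hc⟩, h1⟩
    obtain ⟨b, hb⟩ : PowerSeries.X ^ 2 ∣ e none - e (some 0) := by
      rw [PowerSeries.X_pow_dvd_iff]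
      intro n hn
      rw [map_sub, sub_eq_zero]
      interval_cases n
      · simp [hc]
      · simpa using h1.symm
    refine ⟨(e (some 0)).toMvPowerSeries 0 + MvPowerSeries.X 1 * b.toMvPowerSeries 0, ?_⟩
    rintro (_ | i)
    · rw [evalBranch_tacnode_normalForm_none, ← hb]
      ring
    · rw [evalBranch_tacnode_normalForm_some, Subsingleton.elim i 0]

end Tacnode

/-! ### The cusp -/

section Cusp

/-- The parametrization of the cusp by `x = t ^ 2` and `y = t ^ 3`. -/
noncomputable def cuspBranch (k : Type u) [Field k] : Fin 2 → PowerSeries k :=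
  ![PowerSeries.X ^ 2, PowerSeries.X ^ 3]

lemma constantCoeff_cuspBranch (j : Fin 2) :
    PowerSeries.constantCoeff (cuspBranch k j) = 0 := by
  fin_cases j <;> simp [cuspBranch]

lemma evalBranch_cusp_normalForm (a b : PowerSeries k) :
    evalBranch (cuspBranch k) constantCoeff_cuspBranch
      (a.toMvPowerSeries 0 + MvPowerSeries.X 1 * b.toMvPowerSeries 0) =
      a.expand 2 two_ne_zero + PowerSeries.X ^ 3 * b.expand 2 two_ne_zero := by
  have h : ∀ p : PowerSeries k, evalBranch (cuspBranch k) constantCoeff_cuspBranch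
      (p.toMvPowerSeries 0) = p.expand 2 two_ne_zero :=
    evalBranch_toMvPowerSeries_eq _ (PowerSeries.expand 2 two_ne_zero)
      (PowerSeries.expand_X _ two_ne_zero)
  rw [map_add, map_mul, evalBranch_X, h, h]
  rfl

lemma coeff_cusp_even (a b : PowerSeries k) (n : ℕ) :
    PowerSeries.coeff (2 * n) (a.expand 2 two_ne_zero +
      PowerSeries.X ^ 3 * b.expand 2 two_ne_zero) = PowerSeries.coeff n a := by
  rw [map_add, PowerSeries.coeff_expand_mul, PowerSeries.coeff_X_pow_mul']
  split_ifs with h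
  · rw [PowerSeries.coeff_expand_of_not_dvd _ _ _ (by omega), add_zero]
  · rw [add_zero]

lemma coeff_cusp_odd (a b : PowerSeries k) (n : ℕ) :
    PowerSeries.coeff (2 * n + 3) (a.expand 2 two_ne_zero +
      PowerSeries.X ^ 3 * b.expand 2 two_ne_zero) = PowerSeries.coeff n b := by
  rw [map_add, PowerSeries.coeff_expand_of_not_dvd _ _ _ (by omega), zero_add,
    PowerSeries.coeff_X_pow_mul, PowerSeries.coeff_expand_mul]

/-- Every power series is of the form `a (x) + y b (x)` modulo the equation of the cusp and any
power of the maximal ideal. -/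
lemma exists_cusp_normalForm (n : ℕ) (f : MvPowerSeries (Fin 2) k) : ∃ a b : PowerSeries k,
    f - (a.toMvPowerSeries 0 + MvPowerSeries.X 1 * b.toMvPowerSeries 0) ∈
      cuspIdeal k ⊔ maximalIdeal (MvPowerSeries (Fin 2) k) ^ n := by
  induction n generalizing f with
  | zero => exact ⟨0, 0, by simp⟩
  | succ n ih =>
    obtain ⟨g, hg⟩ := exists_eq_C_add_sum_X_mul f
    rw [Fin.sum_univ_two] at hg
    obtain ⟨a, b, h0⟩ := ih (g 0)
    obtain ⟨a', b', h1⟩ := ih (g 1)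
    have hX : ∀ j : Fin 2, ∀ w ∈ cuspIdeal k ⊔ maximalIdeal (MvPowerSeries (Fin 2) k) ^ n,
        MvPowerSeries.X j * w ∈
          cuspIdeal k ⊔ maximalIdeal (MvPowerSeries (Fin 2) k) ^ (n + 1) := by
      intro j w hw
      have h2 := Ideal.mul_mem_mul (mem_maximalIdeal_iff_constantCoeff.mpr
        (MvPowerSeries.constantCoeff_X (R := k) j)) hw
      rw [Ideal.mul_sup, ← pow_succ'] at h2
      exact (sup_le_sup_right Ideal.mul_le_right _ :
        _ ≤ cuspIdeal k ⊔ maximalIdeal (MvPowerSeries (Fin 2) k) ^ (n + 1)) h2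
    refine ⟨PowerSeries.C (MvPowerSeries.constantCoeff f) + PowerSeries.X * a +
      PowerSeries.X ^ 3 * b', PowerSeries.X * b + a', ?_⟩
    have hC : (PowerSeries.C (MvPowerSeries.constantCoeff f)).toMvPowerSeries (0 : Fin 2) =
        MvPowerSeries.C (MvPowerSeries.constantCoeff f) :=
      (PowerSeries.toMvPowerSeries (R := k) (0 : Fin 2)).commutes _
    have hrel : (MvPowerSeries.X 1 ^ 2 - MvPowerSeries.X 0 ^ 3 : MvPowerSeries (Fin 2) k) *
        b'.toMvPowerSeries 0 ∈
          cuspIdeal k ⊔ maximalIdeal (MvPowerSeries (Fin 2) k) ^ (n + 1) :=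
      Ideal.mem_sup_left (Ideal.mul_mem_right _ _ (Ideal.subset_span rfl))
    convert add_mem (add_mem (hX 0 _ h0) (hX 1 _ h1)) hrel using 1
    conv_lhs => enter [1]; rw [hg]
    simp only [map_add, map_mul, map_pow, hC, PowerSeries.toMvPowerSeries_X]
    ring

lemma X_pow_dvd_evalBranch {σ : Type*} [Fintype σ] {v : σ → PowerSeries k}
    (hv : ∀ j, PowerSeries.constantCoeff (v j) = 0) {n : ℕ} {f : MvPowerSeries σ k}
    (hf : f ∈ maximalIdeal (MvPowerSeries σ k) ^ n) :
    PowerSeries.X ^ n ∣ evalBranch v hv f := by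
  have h : maximalIdeal (MvPowerSeries σ k) ≤
      (Ideal.span {PowerSeries.X}).comap (evalBranch v hv) := fun g hg => by
    rw [Ideal.mem_comap, Ideal.mem_span_singleton, PowerSeries.X_dvd_iff,
      constantCoeff_evalBranch]
    exact mem_maximalIdeal_iff_constantCoeff.mp hg
  have h1 := Ideal.le_comap_pow _ n (Ideal.pow_right_mono h n hf)
  rwa [Ideal.span_singleton_pow, Ideal.mem_comap, Ideal.mem_span_singleton] at h1

lemma toMvPowerSeries_mem_maximalIdeal_pow {σ : Type*} [Finite σ] (h : σ) {n : ℕ}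
    {p : PowerSeries k} (hp : PowerSeries.X ^ n ∣ p) :
    p.toMvPowerSeries h ∈ maximalIdeal (MvPowerSeries σ k) ^ n := by
  obtain ⟨q, rfl⟩ := hp
  rw [map_mul, map_pow, PowerSeries.toMvPowerSeries_X]
  exact Ideal.mul_mem_right _ _ (Ideal.pow_mem_pow
    (mem_maximalIdeal_iff_constantCoeff.mpr (MvPowerSeries.constantCoeff_X h)) n)

theorem nonempty_foldRing_equiv_cusp :
    Nonempty (foldRing k (Fin 0) ≃ₐ[k] MvPowerSeries (Fin 2) k ⧸ cuspIdeal k) := by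
  have hle : cuspIdeal k ≤ RingHom.ker (evalBranch (cuspBranch k) constantCoeff_cuspBranch) := by
    rw [cuspIdeal, Ideal.span_le, Set.singleton_subset_iff]
    change evalBranch _ _ _ = 0
    simp only [map_sub, map_pow, evalBranch_X]
    simp only [cuspBranch, Matrix.cons_val_zero, Matrix.cons_val_one]
    ring
  refine nonempty_foldRing_equiv_quotient _ (fun _ => cuspBranch k)
    (fun _ => constantCoeff_cuspBranch) ?_ ?_ ?_
  · intro j
    fin_cases j <;> simp [cuspBranch, PowerSeries.coeff_X_pow]
  · intro f
    refine ⟨fun hf _ => hle hf, fun hf => mem_of_forall_mem_sup_pow fun n => ?_⟩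
    -- `a` and `b` are the even and odd parts of the restriction to the branch, with `y = t ^ 3`, so
    -- that vanishing to order `2 n + 3` of the restriction means vanishing to order `n` of both.
    obtain ⟨a, b, hab⟩ := exists_cusp_normalForm (2 * n + 3) f
    have hdvd : PowerSeries.X ^ (2 * n + 3) ∣ a.expand 2 two_ne_zero +
        PowerSeries.X ^ 3 * b.expand 2 two_ne_zero := by
      obtain ⟨w, hw, z, hz, hwz⟩ := Submodule.mem_sup.mp hab
      have h1 := congrArg (evalBranch (cuspBranch k) constantCoeff_cuspBranch) hwz
      rw [map_add, RingHom.mem_ker.mp (hle hw), zero_add, map_sub, hf none, zero_sub,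
        evalBranch_cusp_normalForm] at h1
      rw [← dvd_neg, ← h1]
      exact X_pow_dvd_evalBranch _ hz
    rw [PowerSeries.X_pow_dvd_iff] at hdvd
    have ha : PowerSeries.X ^ n ∣ a := PowerSeries.X_pow_dvd_iff.mpr fun j hj => by
      rw [← coeff_cusp_even a b, hdvd _ (by omega)]
    have hb : PowerSeries.X ^ n ∣ b := PowerSeries.X_pow_dvd_iff.mpr fun j hj => by
      rw [← coeff_cusp_odd a b, hdvd _ (by omega)]
    have h2 := add_mem (toMvPowerSeries_mem_maximalIdeal_pow (0 : Fin 2) ha)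
      (Ideal.mul_mem_left _ (MvPowerSeries.X 1) (toMvPowerSeries_mem_maximalIdeal_pow 0 hb))
    have h3 := add_mem ((sup_le_sup_left (Ideal.pow_le_pow_right (by omega)) _ :
      _ ≤ cuspIdeal k ⊔ maximalIdeal (MvPowerSeries (Fin 2) k) ^ n) hab) (Ideal.mem_sup_right h2)
    rwa [sub_add_cancel] at h3
  · rintro e ⟨-, h1⟩
    refine ⟨(PowerSeries.mk fun n => PowerSeries.coeff (2 * n) (e none)).toMvPowerSeries 0 +
      MvPowerSeries.X 1 *
        (PowerSeries.mk fun n => PowerSeries.coeff (2 * n + 3) (e none)).toMvPowerSeries 0, ?_⟩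
    intro i
    rw [Subsingleton.elim i none, evalBranch_cusp_normalForm]
    ext n
    rcases Nat.even_or_odd' n with ⟨r, rfl | rfl⟩
    · rw [coeff_cusp_even, PowerSeries.coeff_mk]
    · rcases r with _ | r
      · rw [map_add, PowerSeries.coeff_expand_of_not_dvd _ _ _ (by omega), zero_add,
          PowerSeries.coeff_X_pow_mul', if_neg (by omega)]
        simpa using h1
      · rw [show 2 * (r + 1) + 1 = 2 * r + 3 by ring, coeff_cusp_odd, PowerSeries.coeff_mk]

end Cusp

end PlaneModels

/-! ### The branches of a one-dimensional local ring -/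

section Branches

open PowerSeries Function

variable {k R : Type u} [Field k] [CommRing R] [IsLocalRing R] [Algebra k R]

variable (R) in
/-- The points of the normalization of a local ring `R` that lie over the closed point. -/
abbrev Branch : Type u :=
  ↥(PrimeSpectrum.comap (algebraMap R (normalizationRing R)) ⁻¹' {closedPoint R})

variable (R) in
/-- The intersection of the maximal ideals of the normalization over the closed point. -/
def branchIdeal : Ideal (normalizationRing R) :=
  ⨅ P : Branch R, P.1.asIdeal

lemma Branch.comap_eq (P : Branch R) :
    P.1.asIdeal.comap (algebraMap R (normalizationRing R)) = maximalIdeal R :=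
  congrArg PrimeSpectrum.asIdeal P.2

instance : Nonempty (Branch R) := by
  have : FaithfulSMul R (normalizationRing R) :=
    (faithfulSMul_iff_algebraMap_injective _ _).mpr algebraMap_normalizationRing_injective
  obtain ⟨P, hP⟩ := Algebra.IsIntegral.comap_surjective R (normalizationRing R)
    (closedPoint R)
  exact ⟨⟨P, hP⟩⟩

lemma comap_branchIdeal :
    (branchIdeal R).comap (algebraMap R (normalizationRing R)) = maximalIdeal R := by
  rw [branchIdeal, Ideal.comap_iInf]
  simp only [Branch.comap_eq, ciInf_const]

lemma pairwise_isCoprime_branch : Pairwise (IsCoprime on fun P : Branch R => P.1.asIdeal) := by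
  intro P P' h
  have h1 := isMaximal_of_comap_eq P.comap_eq
  have h2 := isMaximal_of_comap_eq P'.comap_eq
  refine Ideal.isCoprime_of_isMaximal fun h' => h ?_
  exact Subtype.ext (PrimeSpectrum.ext h')

/-- If the normalization of `R` is not `R` itself, then the maximal ideal contains a
non-zero-divisor. -/
lemma exists_mem_maximalIdeal_nonZeroDivisors
    (h : LinearMap.range (Algebra.linearMap R (normalizationRing R)) ≠ ⊤) :
    ∃ x ∈ nonZeroDivisors R, x ∈ maximalIdeal R := by
  by_contra! hcon
  refine h (eq_top_iff.mpr fun z _ => ?_)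
  obtain ⟨⟨r, s⟩, hrs⟩ := IsLocalization.surj (nonZeroDivisors R) (z : FractionRing R)
  obtain ⟨v, hv⟩ := (IsLocalRing.notMem_maximalIdeal.mp (hcon s s.2)).exists_right_inv
  refine ⟨v * r, Subtype.ext ?_⟩
  change algebraMap R (FractionRing R) (v * r) = z
  have hv' := congrArg (algebraMap R (FractionRing R)) hv
  rw [map_mul, map_one] at hv'
  rw [map_mul]
  change (z : FractionRing R) * algebraMap R (FractionRing R) s =
    algebraMap R (FractionRing R) r at hrs
  linear_combination (z : FractionRing R) * hv' - algebraMap R (FractionRing R) v * hrs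

lemma exists_isBranchExpansion [IsAlgClosed k] [IsNoetherianRing R] [Ring.KrullDimLE 1 R]
    [Module.Finite R (normalizationRing R)] [Finite (Branch R)] {x : R}
    (hx : x ∈ nonZeroDivisors R) (hxm : x ∈ maximalIdeal R)
    {ρ : R →ₐ[k] k} (hρ : RingHom.ker ρ = maximalIdeal R) :
    ∃ Φ : Branch R → normalizationRing R →ₐ[k] k⟦X⟧, IsBranchExpansion (branchIdeal R) Φ := by
  have key : ∀ P : Branch R, ∃ Φ : normalizationRing R →ₐ[k] k⟦X⟧,
      (∀ n s, X ^ n ∣ Φ s ↔ s ∈ P.1.asIdeal ^ n) ∧ ∀ n g, ∃ s, X ^ n ∣ Φ s - g := by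
    intro P
    have hmax := isMaximal_of_comap_eq P.comap_eq
    obtain ⟨ε, hε⟩ := exists_algHom_ker_eq (k := k) (S := normalizationRing R) hρ P.comap_eq
    obtain ⟨p, hpP, u, hu, hup, hp⟩ := exists_local_generator hx hxm P.comap_eq
    exact exists_branch_expansion (S := normalizationRing R) P.1.asIdeal ε hε hpP hu hup hp
  choose Φ hΦ hsurj using key
  refine ⟨Φ, fun n s => ?_, ?_⟩
  · refine (mem_iInf_pow_iff (S := normalizationRing R) (P := fun P : Branch R => P.1.asIdeal)
      pairwise_isCoprime_branch n s).trans ?_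
    exact forall_congr' fun P => (hΦ P n s).symm
  · exact exists_forall_X_pow_dvd_sub (S := normalizationRing R)
      (P := fun P : Branch R => P.1.asIdeal) pairwise_isCoprime_branch hΦ hsurj

lemma IsBranchExpansion.comp_equiv {S : Type u} [CommRing S] [Algebra k S] {J : Ideal S}
    {κ ι : Type*} {Φ : κ → S →ₐ[k] k⟦X⟧} (hΦ : IsBranchExpansion J Φ) (e : ι ≃ κ) :
    IsBranchExpansion J (Φ ∘ e) where
  mem_pow_iff n s := (hΦ.mem_pow_iff n s).trans e.forall_congr_right.symm
  approx n g := by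
    obtain ⟨s, hs⟩ := hΦ.approx n (g ∘ e.symm)
    exact ⟨s, fun i => by simpa using hs (e i)⟩

lemma isGluing_range [IsNoetherianRing (normalizationRing R)]
    [Module.Finite k (normalizationRing R ⧸
      LinearMap.range (Algebra.linearMap R (normalizationRing R)))]
    {ρ : R →ₐ[k] k} (hρ : RingHom.ker ρ = maximalIdeal R) :
    IsGluing (branchIdeal R) (IsScalarTower.toAlgHom k R (normalizationRing R)).range where
  residue := by
    rintro _ ⟨r, rfl⟩
    refine ⟨ρ r, ?_⟩
    have h1 : r - algebraMap k R (ρ r) ∈ maximalIdeal R := by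
      rw [← hρ, RingHom.mem_ker]
      simp
    rw [← comap_branchIdeal, Ideal.mem_comap, map_sub, ← IsScalarTower.algebraMap_apply] at h1
    exact h1
  conductor := exists_pow_le_range (k := k) fun P hP h =>
    iInf_le (fun P : Branch R => P.1.asIdeal) ⟨⟨P, hP⟩, PrimeSpectrum.ext h⟩

/-- A one-dimensional Gorenstein local ring has type one: an element of the normalization that is
multiplied into `R` by the maximal ideal is unique up to `R` and up to multiplication by an element
of `R`. This is self-injectivity of `R ⧸ (x)`, applied to the classes of `x q₁` and `x q₂`. -/
lemma exists_sub_mul_mem_range [IsNoetherianRing R] [Ring.KrullDimLE 1 R] {d : ℕ}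
    (hR : HasInjectiveDimensionLE (ModuleCat.of R R) d) {x : R} (hx : x ∈ nonZeroDivisors R)
    (hxm : x ∈ maximalIdeal R) {q₁ q₂ : normalizationRing R}
    (hq₁ : q₁ ∉ (algebraMap R (normalizationRing R)).range)
    (h₁ : ∀ b ∈ maximalIdeal R, ∃ r, algebraMap R _ r = q₁ * algebraMap R _ b)
    (h₂ : ∀ b ∈ maximalIdeal R, ∃ r, algebraMap R _ r = q₂ * algebraMap R _ b) :
    ∃ b c : R, q₂ - algebraMap R _ b * q₁ = algebraMap R _ c := by
  obtain ⟨r₁, hr₁⟩ := h₁ x hxm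
  obtain ⟨r₂, hr₂⟩ := h₂ x hxm
  obtain ⟨a, ha⟩ := exists_smul_eq_of_annihilator_le hR hx hxm (isFiniteLength_quotient_span hx)
    (Ideal.Quotient.mk _ r₁) (Ideal.Quotient.mk _ r₂) (fun r hr => by
      change Ideal.Quotient.mk _ (r * r₁) = 0 at hr
      change Ideal.Quotient.mk _ (r * r₂) = 0
      rw [Ideal.Quotient.eq_zero_iff_mem, Ideal.mem_span_singleton] at hr ⊢
      have hrm : r ∈ maximalIdeal R := by
        by_contra hrm
        obtain ⟨v, hv⟩ := (IsLocalRing.notMem_maximalIdeal.mp hrm).exists_right_inv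
        obtain ⟨t, ht⟩ := hr
        refine hq₁ ⟨v * t, ?_⟩
        rw [← sub_eq_zero]
        refine mul_eq_zero_of_nonZeroDivisors hx ?_
        have ht' := congrArg (algebraMap R (normalizationRing R)) ht
        have hv' := congrArg (algebraMap R (normalizationRing R)) hv
        simp only [map_mul, map_one] at ht' hv' ⊢
        linear_combination (-algebraMap R (normalizationRing R) v) * ht' +
          algebraMap R (normalizationRing R) r₁ * hv' + hr₁
      obtain ⟨t, ht⟩ := h₂ r hrm
      refine ⟨t, algebraMap_normalizationRing_injective ?_⟩
      rw [map_mul, map_mul, ht, hr₂]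
      ring)
  change Ideal.Quotient.mk _ r₂ = Ideal.Quotient.mk _ (a * r₁) at ha
  rw [Ideal.Quotient.eq, Ideal.mem_span_singleton] at ha
  obtain ⟨t, ht⟩ := ha
  refine ⟨a, t, ?_⟩
  rw [← sub_eq_zero]
  refine mul_eq_zero_of_nonZeroDivisors hx ?_
  have ht' := congrArg (algebraMap R (normalizationRing R)) ht
  simp only [map_mul, map_sub] at ht'
  linear_combination ht' - hr₂ + algebraMap R (normalizationRing R) a * hr₁

lemma finite_and_nontrivial_of_finrank_eq_succ {V : Type*} [AddCommGroup V] [Module k V] {n : ℕ}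
    (h : Module.finrank k V = n + 1) : Module.Finite k V ∧ Nontrivial V :=
  ⟨Module.finite_of_finrank_pos (by omega), Module.nontrivial_of_finrank_pos (R := k) (by omega)⟩

lemma branchNumber_eq_card : branchNumber R = ENat.card (Branch R) := rfl

/-! ### Local rings of genus one -/

/-- A `k`-algebra of type one whose codimension in `S` is the number of branches has `foldRing` as
its completion. -/
theorem IsBranchExpansion.nonempty_adicCompletion_equiv {R S : Type u} [CommRing R] [CommRing S]
    [Algebra k R] [Algebra R S] [Algebra k S] [IsScalarTower k R S]
    (hinj : Function.Injective (algebraMap R S)) {I : Ideal R} {J : Ideal S}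
    (hIJ : J.comap (algebraMap R S) = I) {n : ℕ} {Φ : Option (Fin n) → S →ₐ[k] k⟦X⟧}
    (hΦ : IsBranchExpansion J Φ) (hB : IsGluing J (IsScalarTower.toAlgHom k R S).range)
    (hrank : Module.finrank k (S ⧸ LinearMap.range (Algebra.linearMap R S)) = n + 1)
    (htype : ∀ q₁ q₂ : S, q₁ ∉ (algebraMap R S).range →
      (∀ b ∈ I, ∃ r, algebraMap R S r = q₁ * algebraMap R S b) →
      (∀ b ∈ I, ∃ r, algebraMap R S r = q₂ * algebraMap R S b) →
      ∃ b c : R, q₂ - algebraMap R S b * q₁ = algebraMap R S c) :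
    Nonempty (AdicCompletion I R ≃ₐ[k] foldRing k (Fin n)) := by
  let E := Submodule.Quotient.restrictScalarsEquiv k (LinearMap.range (Algebra.linearMap R S))
  have hrank' : Module.finrank k (S ⧸ Subalgebra.toSubmodule
      (IsScalarTower.toAlgHom k R S).range) = n + 1 := E.finrank_eq.trans hrank
  have := (finite_and_nontrivial_of_finrank_eq_succ hrank').1
  obtain ⟨y, hyJ, hyB, hy⟩ := hΦ.exists_generator_mod hB (by simpa using hrank')
  obtain ⟨a, ha, hmem⟩ := hΦ.exists_forall_mem_iff hB hyJ hyB hy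
  refine nonempty_adicCompletion_equiv_foldRing hinj hIJ hΦ
    (hΦ.coefficient_ne_zero hB hyJ hyB hy ?_ ha hmem) hmem
  intro q₁ q₂ hq₁ h₁ h₂
  have hI : ∀ b ∈ I, algebraMap R S b ∈ J := fun b hb => by rwa [← hIJ] at hb
  obtain ⟨b, c, hbc⟩ := htype q₁ q₂ hq₁ (fun b hb => h₁ _ ⟨b, rfl⟩ (hI b hb))
    (fun b hb => h₂ _ ⟨b, rfl⟩ (hI b hb))
  exact ⟨algebraMap R S b, ⟨b, rfl⟩, c, hbc.symm⟩

lemma ne_top_of_nontrivial_quotient {A V : Type*} [CommRing A] [AddCommGroup V] [Module A V]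
    (W : Submodule A V) (h : Nontrivial (V ⧸ W)) : W ≠ ⊤ :=
  Submodule.Quotient.nontrivial_iff.mp h

theorem nonempty_adicCompletion_equiv_foldRing_of_genus_eq_one [IsAlgClosed k]
    [IsNoetherianRing R] [Ring.KrullDimLE 1 R] {d : ℕ}
    (hR : HasInjectiveDimensionLE (ModuleCat.of R R) d) {m : ℕ} (hm : branchNumber R = m)
    (hg : genus k R = 1) :
    ∃ n, m = n + 1 ∧ Nonempty (AdicCompletion (maximalIdeal R) R ≃ₐ[k] foldRing k (Fin n)) := by
  have hcard : Nat.card (Branch R) = m := by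
    have := congrArg ENat.toNat hm
    rwa [ENat.toNat_natCast] at this
  have : Finite (Branch R) := by
    rw [← ENat.card_lt_top, ← branchNumber_eq_card, hm]
    exact ENat.natCast_lt_top m
  obtain ⟨n, rfl⟩ : ∃ n, m = n + 1 := Nat.exists_eq_succ_of_ne_zero (hcard ▸ Nat.card_pos.ne')
  refine ⟨n, rfl, ?_⟩
  have hδ : deltaInvariant k R = n + 1 := by
    rw [genus, hm, ENat.toNat_natCast] at hg
    omega
  -- As `δ` is positive, it is a genuine dimension.
  obtain ⟨hfin, hnt⟩ := finite_and_nontrivial_of_finrank_eq_succ hδ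
  have : Module.Finite R (normalizationRing R) := finite_of_finite_quotient_range (k := k)
  have : IsNoetherianRing (normalizationRing R) := IsNoetherianRing.of_finite R _
  obtain ⟨x, hx, hxm⟩ := exists_mem_maximalIdeal_nonZeroDivisors (R := R)
    (ne_top_of_nontrivial_quotient _ hnt)
  obtain ⟨ρ, hρ⟩ := exists_residue_algHom (k := k) (R := R) (V := normalizationRing R ⧸
    LinearMap.range (Algebra.linearMap R (normalizationRing R)))
  obtain ⟨Φ, hΦ⟩ := exists_isBranchExpansion hx hxm hρ
  let e : Option (Fin n) ≃ Branch R :=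
    (finSuccEquiv n).symm.trans (Finite.equivFinOfCardEq hcard).symm
  exact (hΦ.comp_equiv e).nonempty_adicCompletion_equiv (S := normalizationRing R)
    algebraMap_normalizationRing_injective comap_branchIdeal (isGluing_range hρ) hδ
    fun q₁ q₂ => exists_sub_mul_mem_range hR hx hxm

theorem isEllipticAlgebra_adicCompletion [IsAlgClosed k] [IsNoetherianRing R]
    [Ring.KrullDimLE 1 R] {d : ℕ} (hR : HasInjectiveDimensionLE (ModuleCat.of R R) d) {m : ℕ}
    (hm : branchNumber R = m) (hg : genus k R = 1) :
    IsEllipticAlgebra k (AdicCompletion (maximalIdeal R) R) m := by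
  obtain ⟨n, rfl, ⟨φ⟩⟩ :=
    nonempty_adicCompletion_equiv_foldRing_of_genus_eq_one hR hm hg
  match n, φ with
  | 0, φ => exact nonempty_foldRing_equiv_cusp.map φ.trans
  | 1, φ => exact nonempty_foldRing_equiv_tacnode.map φ.trans
  | 2, φ => exact nonempty_foldRing_equiv_triplePoint.map φ.trans
  | n + 3, φ => exact (nonempty_foldRing_equiv_generalLines n).map φ.trans

end Branches

/-! ### Points of curves -/

lemma krullDimLE_stalk {X : Scheme.{u}} {n : ℕ} (hX : topologicalKrullDim X ≤ n) (x : X) :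
    Ring.KrullDimLE n (X.presheaf.stalk x) := by
  have h := (X.fromSpecStalk x).isEmbedding.isInducing.topologicalKrullDim_le
  have h1 := PrimeSpectrum.topologicalKrullDim_eq_ringKrullDim (X.presheaf.stalk x)
  rw [Ring.krullDimLE_iff, ← h1]
  exact h.trans hX

end CurveSing

/-- A Gorenstein point of a curve over an algebraically closed field that has `m` branches and
genus one is an elliptic `m`-fold point. -/
theorem propositionA2 {k : Type u} [Field k] [IsAlgClosed k] {C : Scheme.{u}}
    (f : C ⟶ Spec (CommRingCat.of k)) (hC : CurveSing.IsCurve f) (p : C) (m : ℕ)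
    (hGor : CurveSing.IsGorensteinAt p)
    (hm : CurveSing.branchNumberAt p = (m : ℕ∞))
    (hg : CurveSing.genusAt f p = 1) :
    CurveSing.IsEllipticFoldPoint f p m := by
  let _ := CurveSing.stalkAlgebra f p
  have := hGor.isNoetherianRing
  have : Ring.KrullDimLE 1 (C.presheaf.stalk p) := CurveSing.krullDimLE_stalk hC.dim_eq_one.le p
  obtain ⟨d, hd⟩ := hGor.finite_injectiveDimension
  exact CurveSing.isEllipticAlgebra_adicCompletion (k := k) hd hm hg
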